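/- Let $R$ be an associative unital ring and work in the category of right $R$-modules. Let $\kappa$ be an infinite regular cardinal. A directed system $\mathcal M=(M_i,f_{ji}\colon M_i\to M_j\mid i\le j\in I)$ of modules, indexed by a nonempty upward directed partially ordered set $(I,\le)$, is called $\kappa$-continuous if for every nonempty totally ordered subset $J\subseteq I$ with $|J|<\kappa$ the supremum $\sup J$ exists in $I$ and $M_{\sup J}=\varinjlim_{j\in J}M_j$ (via the maps $f_{\sup J,\,j}$). For a class $\mathcal B$ of modules let ${}^\perp\mathcal B$ be the class of all modules $M$ with $\operatorname{Ext}^1_R(M,B)=0$ for all $B\in\mathcal B$. For a class $\mathcal S$ of modules let $\operatorname{Filt}(\mathcal S)$ be the class of all modules $M$ that have, for some ordinal $\sigma$, a chain of submodules $(M_\alpha\mid\alpha\le\sigma)$ with $M_0=0$, $M_\sigma=M$, $M_\alpha\subseteq M_\beta$ for $\alpha<\beta\le\sigma$, $M_\alpha=\bigcup_{\beta<\alpha}M_\beta$ for each limit ordinal $\alpha\le\sigma$, and $M_{\alpha+1}/M_\alpha$ isomorphic to a member of $\mathcal S$ for each $\alpha<\sigma$. Theorem. Let $\mathcal A$ be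 a class of right $R$-modules (closed under isomorphic images) which is closed under direct limits of $\kappa^+$-continuous directed systems of modules. Then $\mathcal A$ is closed under direct limits of $\kappa$-continuous directed systems of modules, provided that at least one of the following conditions holds: (i) $\mathcal A={}^\perp\mathcal B$ for some class $\mathcal B$ of right $R$-modules; (ii) $\mathcal A=\operatorname{Filt}(\mathcal S)$ for some set $\mathcal S$ of right $R$-modules, and $\mathcal A$ is closed under direct summands. -/

import Mathlib

open CategoryTheory CategoryTheory.Limits

universe u

section

variable {A : Type u} [Ring A]

/-- The subsystem of a directed system `F : I ⥤ ModuleCat A` indexed by a subset `J` of `I`. -/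
abbrev subsystem {I : Type u} [PartialOrder I] (F : I ⥤ ModuleCat.{u} A) (J : Set I) :
    J ⥤ ModuleCat.{u} A :=
  (Subtype.mono_coe (fun i : I => i ∈ J)).functor ⋙ F

/-- For an upper bound `s` of `J`, the module `F.obj s` together with the maps
`F.obj j ⟶ F.obj s`, `j ∈ J`, of the system, as a cocone under the subsystem indexed by `J`. -/
def subsystemCocone {I : Type u} [PartialOrder I] (F : I ⥤ ModuleCat.{u} A) (J : Set I) (s : I)
    (hs : s ∈ upperBounds J) : Cocone (subsystem F J) where
  pt := F.obj s
  ι :=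
    { app := fun j => F.map (homOfLE (hs j.2))
      naturality := fun i j f => by
        simp only [Functor.comp_map, Functor.const_obj_map]
        rw [← F.map_comp]
        rfl }

/-- A directed system `F` is `κ`-continuous if every nonempty chain `J` of fewer than `κ` indices
has a supremum `s` in the index set and `F.obj s`, with the maps of the system, is the direct limit
of the subsystem indexed by `J`. -/
def IsKContinuous (κ : Cardinal.{u}) {I : Type u} [PartialOrder I] (F : I ⥤ ModuleCat.{u} A) :
    Prop :=
  ∀ J : Set I, J.Nonempty → IsChain (· ≤ ·) J → Cardinal.mk J < κ →
    ∃ (s : I) (hs : IsLUB J s), Nonempty (IsColimit (subsystemCocone F J s hs.1))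

/-- The class `P` is closed under direct limits of `κ`-continuous directed systems. -/
def ClosedUnderKContinuousLimits (κ : Cardinal.{u}) (P : ObjectProperty (ModuleCat.{u} A)) :
    Prop :=
  ∀ (I : Type u) [PartialOrder I] [IsDirectedOrder I] [Nonempty I] (F : I ⥤ ModuleCat.{u} A),
    IsKContinuous κ F → (∀ i, P (F.obj i)) →
      ∀ c : Cocone F, IsColimit c → P c.pt

/-- The class of all modules `M` such that `Ext¹(M, B) = 0` for every `B` in the class. -/
def leftExtOrthogonal (B : ObjectProperty (ModuleCat.{u} A)) : ObjectProperty (ModuleCat.{u} A) :=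
  fun M => ∀ N : ModuleCat.{u} A, B N → Subsingleton (Abelian.Ext.{u} M N 1)

/-- An `S`-filtration of the module `M`, of length `σ`; only the values `F α` with `α ≤ σ`
matter. -/
structure IsFiltrationBy (S : ObjectProperty (ModuleCat.{u} A)) (M : ModuleCat.{u} A)
    (σ : Ordinal.{u}) (F : Ordinal.{u} → Submodule A M) : Prop where
  zero : F 0 = ⊥
  top : F σ = ⊤
  mono : ∀ α β, α < β → β ≤ σ → F α ≤ F β
  limit : ∀ α, α ≤ σ → Order.IsSuccLimit α → (F α : Set M) = ⋃ β < α, (F β : Set M)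
  factor : ∀ α, α < σ → ∃ X : ModuleCat.{u} A, S X ∧
    Nonempty ((F (Order.succ α) ⧸ (F α).submoduleOf (F (Order.succ α))) ≃ₗ[A] X)

/-- `Filt(S)`: the class of all modules possessing an `S`-filtration. -/
def FiltClass (S : ObjectProperty (ModuleCat.{u} A)) : ObjectProperty (ModuleCat.{u} A) :=
  fun M => ∃ (σ : Ordinal.{u}) (F : Ordinal.{u} → Submodule A M), IsFiltrationBy S M σ F

/-- The class `P` is closed under direct summands. -/
def ClosedUnderDirectSummands (P : ObjectProperty (ModuleCat.{u} A)) : Prop :=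
  ∀ M X Y : ModuleCat.{u} A, P M → Nonempty (M ≃ₗ[A] (X × Y)) → P X

end

/-! The heart of the matter is a chain `C` of modules in `𝒜` indexed by the initial ordinal of `κ`,
the direct limits of its proper initial segments lying in `𝒜` too. Let `M` be its direct limit. Take
a tree of height `κ` with at most `μ` nodes and `2 ^ μ` branches, `μ` being as large as desired. Put
a copy of `C β` at every node of level `β`, and let `L` be generated by the elements that spread
some `x` in `C α` along a branch from level `α` upwards. Differences of two such elements on one
branch are bounded segments; they depend only on nodes and span a submodule of size at most `μ`.
Modulo these segments the branches become independent, so `L` maps onto a direct sum of `2 ^ μ`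
copies of `M` with kernel of size at most `μ`.

The span of at most `κ` branches is filtered by members of `𝒜`: by regularity of `κ` each branch
leaves all earlier ones at some level, and it contributes only modules `C α` and possibly one direct
limit of a proper initial segment. As `𝒜` is closed under filtrations, and `L` is the union of a
`κ⁺`-continuous system of such spans, `L` lies in `𝒜` (`exists_tree_module`).

Counting carries membership from `L` to `M`. In case (i), Ext-vanishing is a lifting property; there
are `2 ^ 2 ^ μ` maps from the direct sum to lift but only `2 ^ μ` restrictions of lifts to the
kernel, so two lifts agree there and their difference yields a lift from `M`
(`liftsAlong_of_small_kernel`). In case (ii), a Hill-type argument factors out the preimage of a sum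
of at most `μ` copies so that the quotient stays filtered and has `M` as a direct summand
(`exists_filtClass_summand`).

A general system is reindexed by the finite subsets of its index set. Its limit is a `κ⁺`-continuous
limit of the limits over finite subsets of `Y`, where `|Y| ≤ κ`. For `|Y| < κ` such a limit is a
member of the system; for `|Y| = κ` it is the limit of a chain as above (`colimit_finsetsIn_mem`).
-/

set_option autoImplicit false

/-! ### Filtrations as well-ordered families of submodules. -/

section Filtrations

variable {A : Type u} [Ring A] {P : Type u} [AddCommGroup P] [Module A P]

/-- The submodule `N'` equals `N`, or it contains `N` and `N'/N` is isomorphic to a member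
of `S`. -/
def IsStep (S : ObjectProperty (ModuleCat.{u} A)) (N N' : Submodule A P) : Prop :=
  N = N' ∨ (N ≤ N' ∧ ∃ X : ModuleCat.{u} A, S X ∧ ∃ φ : X →ₗ[A] P ⧸ N,
    Function.Injective φ ∧ LinearMap.range φ = N'.map N.mkQ)

/-- The sum of `N` and of all members of the family `G` with index less than `i`. -/
def stageLT {ι : Type u} [LinearOrder ι] (N : Submodule A P) (G : ι → Submodule A P) (i : ι) :
    Submodule A P :=
  N ⊔ ⨆ j, ⨆ (_ : j < i), G j

/-- The sum of `N` and of all members of the family `G` with index at most `i`. -/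
def stageLE {ι : Type u} [LinearOrder ι] (N : Submodule A P) (G : ι → Submodule A P) (i : ι) :
    Submodule A P :=
  N ⊔ ⨆ j, ⨆ (_ : j ≤ i), G j

/-- `N'` is reached from `N` by a well-ordered family of submodules whose consecutive factors are
zero or isomorphic to members of `S`. -/
def IsFilteredOver (S : ObjectProperty (ModuleCat.{u} A)) (N N' : Submodule A P) : Prop :=
  ∃ (ι : Type u) (_ : LinearOrder ι) (_ : WellFoundedLT ι) (G : ι → Submodule A P),
    N ⊔ ⨆ i, G i = N' ∧ ∀ i, IsStep S (stageLT N G i) (stageLE N G i)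

section Stages

variable {ι : Type u} [LinearOrder ι] (N : Submodule A P) (G : ι → Submodule A P)

theorem stageLT_le_iff {i : ι} {K : Submodule A P} :
    stageLT N G i ≤ K ↔ N ≤ K ∧ ∀ j < i, G j ≤ K := by
  simp [stageLT]

theorem stageLE_le_iff {i : ι} {K : Submodule A P} :
    stageLE N G i ≤ K ↔ N ≤ K ∧ ∀ j ≤ i, G j ≤ K := by
  simp [stageLE]

theorem le_stageLT (i : ι) : N ≤ stageLT N G i := ((stageLT_le_iff N G).1 le_rfl).1

theorem le_stageLE (i : ι) : N ≤ stageLE N G i := ((stageLE_le_iff N G).1 le_rfl).1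

theorem self_le_stageLT {j i : ι} (h : j < i) : G j ≤ stageLT N G i :=
  ((stageLT_le_iff N G).1 le_rfl).2 j h

theorem self_le_stageLE {j i : ι} (h : j ≤ i) : G j ≤ stageLE N G i :=
  ((stageLE_le_iff N G).1 le_rfl).2 j h

theorem stageLE_eq (i : ι) : stageLE N G i = stageLT N G i ⊔ G i := by
  apply le_antisymm
  · refine (stageLE_le_iff N G).2 ⟨(le_stageLT N G i).trans le_sup_left, fun j hj => ?_⟩
    rcases hj.lt_or_eq with h | rfl
    · exact (self_le_stageLT N G h).trans le_sup_left
    · exact le_sup_right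
  · refine sup_le ((stageLT_le_iff N G).2 ⟨le_stageLE N G i, fun j hj => ?_⟩) ?_
    · exact self_le_stageLE N G hj.le
    · exact self_le_stageLE N G le_rfl

theorem stageLT_le_stageLE (i : ι) : stageLT N G i ≤ stageLE N G i := by
  rw [stageLE_eq]; exact le_sup_left

theorem stageLE_le_stageLT {j i : ι} (h : j < i) : stageLE N G j ≤ stageLT N G i :=
  (stageLE_le_iff N G).2 ⟨le_stageLT N G i, fun _ hk => self_le_stageLT N G (hk.trans_lt h)⟩

theorem stageLE_mono {j i : ι} (h : j ≤ i) : stageLE N G j ≤ stageLE N G i := by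
  rcases h.lt_or_eq with h | rfl
  · exact (stageLE_le_stageLT N G h).trans (stageLT_le_stageLE N G i)
  · exact le_rfl

/-- The earlier stages form a chain, so their sum is their union; `N` has to be listed separately
for the least index. -/
theorem mem_stageLT_iff {i : ι} {x : P} :
    x ∈ stageLT N G i ↔ x ∈ N ∨ ∃ j < i, x ∈ stageLE N G j := by
  constructor
  · intro hx
    rcases isEmpty_or_nonempty (Set.Iio i) with he | he
    · left
      have : stageLT N G i ≤ N := (stageLT_le_iff N G).2
        ⟨le_rfl, fun j hj => (he.false ⟨j, hj⟩).elim⟩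
      exact this hx
    · right
      have : stageLT N G i ≤ ⨆ j : Set.Iio i, stageLE N G j := (stageLT_le_iff N G).2
        ⟨(le_stageLE N G _).trans (le_iSup (fun j : Set.Iio i => stageLE N G j) he.some),
          fun j hj => (self_le_stageLE N G le_rfl).trans
            (le_iSup (fun j : Set.Iio i => stageLE N G j) ⟨j, hj⟩)⟩
      have hx' := this hx
      rw [Submodule.mem_iSup_of_directed] at hx'
      · obtain ⟨j, hj⟩ := hx'
        exact ⟨j, j.2, hj⟩
      · exact Monotone.directed_le fun a b h => stageLE_mono N G h
  · rintro (h | ⟨j, hj, h⟩)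
    · exact le_stageLT N G i h
    · exact stageLE_le_stageLT N G hj h

end Stages

theorem isStep_of_map {S : ObjectProperty (ModuleCat.{u} A)} {N : Submodule A P}
    {X : ModuleCat.{u} A} (hX : S X) (φ : X →ₗ[A] P) (h : ∀ x, φ x ∈ N → x = 0) :
    IsStep S N (N ⊔ LinearMap.range φ) := by
  refine Or.inr ⟨le_sup_left, X, hX, N.mkQ ∘ₗ φ, ?_, ?_⟩
  · rw [← LinearMap.ker_eq_bot, LinearMap.ker_eq_bot']
    intro x hx
    exact h x (by simpa using hx)
  · rw [LinearMap.range_comp, Submodule.map_sup]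
    simp

/-- The canonical map `N'/N → P/N`. -/
theorem exists_quotient_map {N N' : Submodule A P} :
    ∃ φ : (N' ⧸ N.submoduleOf N') →ₗ[A] P ⧸ N, Function.Injective φ ∧
      LinearMap.range φ = N'.map N.mkQ := by
  unfold Submodule.submoduleOf
  refine ⟨Submodule.mapQ _ N N'.subtype le_rfl, ?_, ?_⟩
  · rw [← LinearMap.ker_eq_bot, Submodule.ker_mapQ]
    exact Submodule.mkQ_map_self _
  · rw [Submodule.range_mapQ, Submodule.range_subtype]

theorem isStep_of_equiv {S : ObjectProperty (ModuleCat.{u} A)} {N N' : Submodule A P}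
    (h : N ≤ N') {X : ModuleCat.{u} A} (hX : S X)
    (e : (N' ⧸ N.submoduleOf N') ≃ₗ[A] X) : IsStep S N N' := by
  obtain ⟨φ, h₁, h₂⟩ := exists_quotient_map (N := N) (N' := N')
  refine Or.inr ⟨h, X, hX, φ ∘ₗ e.symm.toLinearMap, ?_, ?_⟩
  · exact h₁.comp e.symm.injective
  · rw [LinearMap.range_comp, LinearEquiv.range, Submodule.map_top, h₂]

theorem IsStep.exists_equiv {S : ObjectProperty (ModuleCat.{u} A)} {N N' : Submodule A P}
    (h : IsStep S N N') (hne : N ≠ N') : ∃ X : ModuleCat.{u} A, S X ∧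
      Nonempty ((N' ⧸ N.submoduleOf N') ≃ₗ[A] X) := by
  obtain h | ⟨hle, X, hX, φ, h₁, h₂⟩ := h
  · exact (hne h).elim
  obtain ⟨ψ, h₃, h₄⟩ := exists_quotient_map (N := N) (N' := N')
  exact ⟨X, hX, ⟨(LinearEquiv.ofInjective ψ h₃).trans ((LinearEquiv.ofEq _ _ (h₄.trans h₂.symm)).trans
    (LinearEquiv.ofInjective φ h₁).symm)⟩⟩

theorem IsStep.le {S : ObjectProperty (ModuleCat.{u} A)} {N N' : Submodule A P}
    (h : IsStep S N N') : N ≤ N' := by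
  obtain h | h := h
  · exact h.le
  · exact h.1

theorem IsStep.isFilteredOver {S : ObjectProperty (ModuleCat.{u} A)} {N N' : Submodule A P}
    (h : IsStep S N N') : IsFilteredOver S N N' := by
  refine ⟨PUnit, inferInstance, inferInstance, fun _ => N', ?_, fun i => ?_⟩
  · simpa using h.le
  · simpa [stageLT, stageLE, h.le] using h

theorem IsFilteredOver.refl (S : ObjectProperty (ModuleCat.{u} A)) (N : Submodule A P) :
    IsFilteredOver S N N :=
  IsStep.isFilteredOver (Or.inl rfl)

theorem sigmaLex_wellFoundedLT {ι : Type u} [LinearOrder ι] [WellFoundedLT ι] {κ : ι → Type u}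
    [∀ i, LinearOrder (κ i)] [∀ i, WellFoundedLT (κ i)] : WellFoundedLT (Σₗ i, κ i) := by
  constructor
  have := (PSigma.lex ⟨fun a b : ι => a < b, wellFounded_lt⟩
    (fun i => ⟨fun a b : κ i => a < b, wellFounded_lt⟩)).wf
  refine Subrelation.wf ?_ (InvImage.wf (fun x : (Σₗ i, κ i) => (⟨x.1, x.2⟩ : PSigma κ)) this)
  rintro ⟨i, a⟩ ⟨j, b⟩ h
  rcases Sigma.Lex.lt_def.1 h with h | ⟨h, h'⟩
  · exact PSigma.Lex.left _ _ h
  · obtain rfl : i = j := h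
    exact PSigma.Lex.right _ h'

/-- A filtration whose steps are filtered over `S` can be refined to one with steps in `S`. -/
theorem IsFilteredOver.of_steps {S : ObjectProperty (ModuleCat.{u} A)} {ι : Type u}
    [LinearOrder ι] [WellFoundedLT ι] (N : Submodule A P) (G : ι → Submodule A P)
    (h : ∀ i, IsFilteredOver S (stageLT N G i) (stageLE N G i)) :
    IsFilteredOver S N (N ⊔ ⨆ i, G i) := by
  choose κ hlin hwf H hH hstep using h
  have hHle : ∀ i k, H i k ≤ stageLE N G i := fun i k =>
    (le_iSup (H i) k).trans (le_sup_right.trans (hH i).le)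
  -- `H i` generates the stage at `i` only over the preceding stage, so recovering `G i` takes a
  -- transfinite induction.
  have hGle : ∀ (K : Submodule A P) (i : ι), N ≤ K → (∀ j ≤ i, ∀ k, H j k ≤ K) → G i ≤ K := by
    intro K i hN
    induction i using WellFoundedLT.induction with
    | ind i ih =>
      intro hK
      refine (self_le_stageLE N G le_rfl).trans ((hH i).ge.trans (sup_le ?_ (iSup_le (hK i le_rfl))))
      exact (stageLT_le_iff N G).2 ⟨hN, fun j hj => ih j hj fun k hk => hK k (hk.trans hj.le)⟩
  have key : ∀ i, ∀ K : Submodule A P, N ≤ K → (∀ j < i, ∀ k, H j k ≤ K) → stageLT N G i ≤ K :=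
    fun i K hN hK => (stageLT_le_iff N G).2
      ⟨hN, fun j hj => hGle K j hN fun l hl => hK l (hl.trans_lt hj)⟩
  refine ⟨Σₗ i, κ i, inferInstance, sigmaLex_wellFoundedLT, fun x => H x.1 x.2, ?_, ?_⟩
  · apply le_antisymm
    · refine sup_le le_sup_left (iSup_le fun x => (hHle _ _).trans ?_)
      exact (stageLE_le_iff N G).2 ⟨le_sup_left, fun j _ => le_sup_of_le_right (le_iSup G j)⟩
    · refine sup_le le_sup_left (iSup_le fun i => hGle _ i le_sup_left fun j _ k => ?_)
      exact le_sup_of_le_right (le_iSup (fun x : (Σₗ i, κ i) => H x.1 x.2) (toLex ⟨j, k⟩))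
  · rintro ⟨i, k⟩
    -- In the lexicographic order all blocks before `i` come first, so the refined filtration
    -- restarts at the old stage below `i`.
    have hlt : stageLT N (fun x : (Σₗ i, κ i) => H x.1 x.2) ⟨i, k⟩ =
        stageLT (stageLT N G i) (H i) k := by
      apply le_antisymm
      · refine (stageLT_le_iff _ _).2 ⟨(le_stageLT N G i).trans (le_stageLT _ _ _), ?_⟩
        rintro ⟨j, l⟩ hjl
        rcases Sigma.Lex.lt_def.1 hjl with h | ⟨h, h'⟩
        · exact (hHle j l).trans ((stageLE_le_stageLT N G h).trans (le_stageLT _ _ _))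
        · obtain rfl : j = i := h
          exact self_le_stageLT _ (H j) h'
      · refine (stageLT_le_iff _ _).2 ⟨key i _ (le_stageLT _ _ _) ?_, ?_⟩
        · intro j hj l
          exact self_le_stageLT N (fun x : (Σₗ i, κ i) => H x.1 x.2) (j := ⟨j, l⟩)
            (Sigma.Lex.lt_def.2 (Or.inl hj))
        · intro l hl
          exact self_le_stageLT N (fun x : (Σₗ i, κ i) => H x.1 x.2) (j := ⟨i, l⟩)
            (Sigma.Lex.lt_def.2 (Or.inr ⟨rfl, hl⟩))
    have := hstep i k
    rw [stageLE_eq, ← hlt] at this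
    exact (congrArg (IsStep S _) (stageLE_eq N (fun x : (Σₗ i, κ i) => H x.1 x.2) ⟨i, k⟩)).mpr this

theorem IsFilteredOver.le {S : ObjectProperty (ModuleCat.{u} A)} {N N' : Submodule A P}
    (h : IsFilteredOver S N N') : N ≤ N' := by
  obtain ⟨ι, _, _, G, h, -⟩ := h
  exact le_sup_left.trans h.le

/-- Concatenation is the refinement of a filtration with two steps, indexed by `false < true`. -/
theorem IsFilteredOver.trans {S : ObjectProperty (ModuleCat.{u} A)} {N₁ N₂ N₃ : Submodule A P}
    (h₁ : IsFilteredOver S N₁ N₂) (h₂ : IsFilteredOver S N₂ N₃) : IsFilteredOver S N₁ N₃ := by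
  have h₃ := h₁.le
  have h₄ := h₂.le
  have := IsFilteredOver.of_steps (S := S) N₁
    (fun i : ULift.{u} Bool => if i.down then N₃ else N₂) ?_
  · convert this
    apply le_antisymm
    · exact (le_iSup (fun i : ULift.{u} Bool => if i.down then N₃ else N₂) ⟨true⟩).trans
        le_sup_right
    · refine sup_le (h₃.trans h₄) (iSup_le ?_)
      rintro ⟨_ | _⟩
      · simpa using h₄
      · simp
  · have hlt : stageLT N₁ (fun i : ULift.{u} Bool => if i.down then N₃ else N₂) ⟨false⟩ = N₁ := by
      apply le_antisymm
      · refine (stageLT_le_iff _ _).2 ⟨le_rfl, ?_⟩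
        rintro ⟨j⟩ hj
        exact absurd (show j < false from hj) (by simp)
      · exact le_stageLT _ _ _
    have hlt' : stageLT N₁ (fun i : ULift.{u} Bool => if i.down then N₃ else N₂) ⟨true⟩ = N₂ := by
      apply le_antisymm
      · refine (stageLT_le_iff _ _).2 ⟨h₃, ?_⟩
        rintro ⟨_ | _⟩ hj
        · simp
        · exact absurd hj (lt_irrefl _)
      · refine le_trans ?_ (self_le_stageLT _ _ (j := ⟨false⟩) (show false < true by simp))
        simp
    rintro ⟨_ | _⟩
    · rw [stageLE_eq, hlt]; simpa [h₃] using h₁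
    · rw [stageLE_eq, hlt']; simpa [h₄] using h₂

/-- A well-ordered family of maps, each of them injective modulo the sum of the previous images,
yields a filtration. -/
theorem isFilteredOver_of_maps {S : ObjectProperty (ModuleCat.{u} A)} {ι : Type u} [LinearOrder ι]
    [WellFoundedLT ι] (N : Submodule A P) (X : ι → ModuleCat.{u} A) (hX : ∀ i, S (X i))
    (b : ∀ i, X i →ₗ[A] P)
    (h : ∀ i x, b i x ∈ stageLT N (fun j => LinearMap.range (b j)) i → x = 0) :
    IsFilteredOver S N (N ⊔ ⨆ i, LinearMap.range (b i)) := by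
  refine ⟨ι, inferInstance, inferInstance, fun j => LinearMap.range (b j), rfl, fun i => ?_⟩
  rw [stageLE_eq]
  exact isStep_of_map (hX i) (b i) (h i)

end Filtrations

/-! ### Images and preimages of filtrations. -/

section Transport

variable {A : Type u} [Ring A] {P Q : Type u} [AddCommGroup P] [Module A P]
  [AddCommGroup Q] [Module A Q] {S : ObjectProperty (ModuleCat.{u} A)}

/-- The kernel condition makes the induced map `P/V → Q/g(V)` injective, so the factor is preserved.
-/
theorem IsStep.map {V W : Submodule A P} (h : IsStep S V W) (g : P →ₗ[A] Q)
    (hg : LinearMap.ker g ≤ V) : IsStep S (V.map g) (W.map g) := by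
  obtain rfl | ⟨hle, X, hX, φ, h₁, h₂⟩ := h
  · exact Or.inl rfl
  refine Or.inr ⟨Submodule.map_mono hle, X, hX,
    Submodule.mapQ V (V.map g) g (Submodule.le_comap_map _ _) ∘ₗ φ, ?_, ?_⟩
  · rw [LinearMap.coe_comp]
    refine Function.Injective.comp ?_ h₁
    rw [← LinearMap.ker_eq_bot, Submodule.ker_mapQ, Submodule.comap_map_eq, sup_eq_left.2 hg]
    exact Submodule.mkQ_map_self _
  · rw [LinearMap.range_comp, h₂, ← Submodule.map_comp, Submodule.mapQ_mkQ, Submodule.map_comp]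

/-- The map induced by `f` on quotients is injective, and since `W` lies in the range of `f` it hits
all of `W/V`. -/
theorem IsStep.comap {V W : Submodule A P} (h : IsStep S V W) (f : Q →ₗ[A] P)
    (hf : W ≤ LinearMap.range f) : IsStep S (V.comap f) (W.comap f) := by
  obtain rfl | ⟨hle, X, hX, φ, h₁, h₂⟩ := h
  · exact Or.inl rfl
  have hψ : Function.Injective (Submodule.mapQ (V.comap f) V f le_rfl) := by
    rw [← LinearMap.ker_eq_bot, Submodule.ker_mapQ]
    exact Submodule.mkQ_map_self _
  have hW : (((W.comap f).map (V.comap f).mkQ).map (Submodule.mapQ (V.comap f) V f le_rfl)) =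
      LinearMap.range φ := by
    rw [h₂, ← Submodule.map_comp, Submodule.mapQ_mkQ, Submodule.map_comp,
      Submodule.map_comap_eq_of_le hf]
  have hφ : ∀ x, φ x ∈ LinearMap.range (Submodule.mapQ (V.comap f) V f le_rfl) := by
    intro x
    have : φ x ∈ LinearMap.range φ := ⟨x, rfl⟩
    rw [← hW] at this
    exact LinearMap.map_le_range this
  let e := LinearEquiv.ofInjective _ hψ
  have he : ∀ x, Submodule.mapQ (V.comap f) V f le_rfl (e.symm ⟨φ x, hφ x⟩) = φ x := by
    intro x
    have := congrArg Subtype.val (e.apply_symm_apply ⟨φ x, hφ x⟩)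
    simpa only [e, LinearEquiv.ofInjective_apply] using this
  have hcomp : Submodule.mapQ (V.comap f) V f le_rfl ∘ₗ (e.symm.toLinearMap ∘ₗ φ.codRestrict _ hφ) =
      φ := by
    ext x
    exact he x
  refine Or.inr ⟨Submodule.comap_mono hle, X, hX, e.symm.toLinearMap ∘ₗ φ.codRestrict _ hφ, ?_, ?_⟩
  · intro x y hxy
    apply h₁
    rw [← hcomp]
    exact congrArg (Submodule.mapQ (V.comap f) V f le_rfl) hxy
  · apply Submodule.map_injective_of_injective hψ
    rw [hW, ← LinearMap.range_comp, hcomp]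

theorem map_stage {ι : Sort*} (g : P →ₗ[A] Q) (N : Submodule A P) (G : ι → Submodule A P) :
    (N ⊔ ⨆ i, G i).map g = N.map g ⊔ ⨆ i, (G i).map g := by
  rw [Submodule.map_sup, Submodule.map_iSup]

/-- Preimages do not commute with sums in general. Here the part coming from the `G i` can be lifted
to `Q` and subtracted, which leaves an element over `N`; so `N` itself may leave the range. -/
theorem comap_stage {ι : Sort*} (f : Q →ₗ[A] P) (N : Submodule A P) (G : ι → Submodule A P)
    (hG : ∀ i, G i ≤ LinearMap.range f) :
    (N ⊔ ⨆ i, G i).comap f = N.comap f ⊔ ⨆ i, (G i).comap f := by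
  apply le_antisymm
  · intro x hx
    obtain ⟨n, hn, y, hy, hxy⟩ := Submodule.mem_sup.1 hx
    have : (⨆ i, G i) ≤ (⨆ i, (G i).comap f).map f := by
      refine iSup_le fun i => ?_
      rw [← Submodule.map_comap_eq_of_le (hG i)]
      exact Submodule.map_mono (le_iSup (fun i => (G i).comap f) i)
    obtain ⟨k, hk, rfl⟩ := this hy
    rw [← sub_add_cancel x k]
    refine Submodule.add_mem_sup ?_ hk
    rw [Submodule.mem_comap, map_sub, ← hxy, add_sub_cancel_right]
    exact hn
  · refine sup_le (Submodule.comap_mono le_sup_left) (iSup_le fun i => Submodule.comap_mono ?_)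
    exact (le_iSup G i).trans le_sup_right

theorem IsFilteredOver.map {N N' : Submodule A P} (h : IsFilteredOver S N N') (g : P →ₗ[A] Q)
    (hg : LinearMap.ker g ≤ N) : IsFilteredOver S (N.map g) (N'.map g) := by
  obtain ⟨ι, _, _, G, h, hs⟩ := h
  refine ⟨ι, inferInstance, inferInstance, fun i => (G i).map g, ?_, fun i => ?_⟩
  · rw [← h, map_stage]
  · have := (hs i).map g (hg.trans (le_stageLT N G i))
    simpa only [stageLT, stageLE, Submodule.map_sup, Submodule.map_iSup] using this

theorem IsFilteredOver.comap {N N' : Submodule A P} (h : IsFilteredOver S N N') (f : Q →ₗ[A] P)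
    (hf : N' ≤ LinearMap.range f) : IsFilteredOver S (N.comap f) (N'.comap f) := by
  obtain ⟨ι, _, _, G, h, hs⟩ := h
  have hG : ∀ i, G i ≤ LinearMap.range f := fun i => ((le_iSup G i).trans
    (le_sup_right.trans h.le)).trans hf
  have aux : ∀ p : ι → Prop, (N ⊔ ⨆ j, ⨆ (_ : p j), G j).comap f =
      N.comap f ⊔ ⨆ j, ⨆ (_ : p j), (G j).comap f := by
    intro p
    rw [iSup_subtype', iSup_subtype']
    exact comap_stage f N _ fun i => hG i
  refine ⟨ι, inferInstance, inferInstance, fun i => (G i).comap f, ?_, fun i => ?_⟩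
  · rw [← h, comap_stage f N G hG]
  · have hle : stageLE N G i ≤ LinearMap.range f := by
      refine (stageLE_le_iff N G).2 ⟨le_sup_left.trans (h.le.trans hf), fun j _ => hG j⟩
    have := (hs i).comap f hle
    rw [stageLT, stageLE, aux, aux] at this
    exact this

end Transport

/-! ### Ordinal filtrations versus well-ordered families; closure under filtrations. -/

section FiltClassLemmas

variable {A : Type u} [Ring A] {S : ObjectProperty (ModuleCat.{u} A)}

theorem FiltClass.isFilteredOver {M : ModuleCat.{u} A} (h : FiltClass S M) :
    IsFilteredOver S (⊥ : Submodule A M) ⊤ := by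
  obtain ⟨σ, F, hF⟩ := h
  have hmono : ∀ α β, α ≤ β → β ≤ σ → F α ≤ F β := by
    intro α β h hβ
    rcases h.lt_or_eq with h | rfl
    · exact hF.mono α β h hβ
    · exact le_rfl
  have hltσ : ∀ i : σ.ToType, (i.toOrd : Ordinal) < σ := fun i => i.toOrd.2
  -- Every `F α` is generated by the values at successors of smaller ordinals; these successor
  -- values will be the family.
  have hcover : ∀ α, α ≤ σ → ∀ K : Submodule A M,
      (∀ j : σ.ToType, (j.toOrd : Ordinal) < α → F (Order.succ j.toOrd) ≤ K) → F α ≤ K := by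
    intro α hα K hK
    rcases Ordinal.zero_or_succ_or_isSuccLimit α with rfl | ⟨β, rfl⟩ | hlim
    · rw [hF.zero]; exact bot_le
    · have hβ : β < σ := (Order.lt_succ β).trans_le hα
      have := hK (Ordinal.ToType.mk ⟨β, hβ⟩)
      simp only [Ordinal.ToType.toOrd, OrderIso.symm_apply_apply] at this
      exact this (Order.lt_succ β)
    · intro x hx
      have hx' : x ∈ (F α : Set M) := hx
      rw [hF.limit α hα hlim] at hx'
      simp only [Set.mem_iUnion] at hx'
      obtain ⟨β, hβ, hx'⟩ := hx'
      have := hK (Ordinal.ToType.mk ⟨β, hβ.trans_le hα⟩)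
      simp only [Ordinal.ToType.toOrd, OrderIso.symm_apply_apply] at this
      exact this hβ (hmono _ _ (Order.le_succ β)
        ((Order.succ_le_of_lt hβ).trans hα) hx')
  refine ⟨σ.ToType, inferInstance, inferInstance, fun i => F (Order.succ i.toOrd), ?_, fun i => ?_⟩
  · rw [bot_sup_eq, eq_top_iff, ← hF.top]
    exact hcover σ le_rfl _ fun j _ => le_iSup (fun i : σ.ToType => F (Order.succ i.toOrd)) j
  · have h₁ : stageLT ⊥ (fun i : σ.ToType => F (Order.succ i.toOrd)) i = F i.toOrd := by
      apply le_antisymm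
      · refine (stageLT_le_iff _ _).2 ⟨bot_le, fun j hj => hmono _ _ ?_ (hltσ i).le⟩
        exact Order.succ_le_of_lt (Ordinal.ToType.mk.symm.lt_iff_lt.2 hj)
      · refine hcover _ (hltσ i).le _ fun j hj => ?_
        exact self_le_stageLT ⊥ (fun i : σ.ToType => F (Order.succ i.toOrd))
          (Ordinal.ToType.mk.symm.lt_iff_lt.1 hj)
    have h₂ : F i.toOrd ≤ F (Order.succ i.toOrd) :=
      hmono _ _ (Order.le_succ _) (Order.succ_le_of_lt (hltσ i))
    rw [stageLE_eq, h₁, sup_eq_right.2 h₂]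
    obtain ⟨X, hX, ⟨e⟩⟩ := hF.factor i.toOrd (hltσ i)
    exact isStep_of_equiv h₂ hX e

theorem filtClass_of_isFilteredOver {M : ModuleCat.{u} A}
    (h : IsFilteredOver S (⊥ : Submodule A M) ⊤) : FiltClass S M := by
  obtain ⟨ι, _, _, G, h, hs⟩ := h
  set V := stageLT (⊥ : Submodule A M) G with hV
  set W := stageLE (⊥ : Submodule A M) G with hW
  -- Trivial steps are discarded, because an ordinal filtration needs every factor in `S`, which may
  -- not contain zero.
  let J := {i : ι // V i ≠ W i}
  have hWle : ∀ i (K : Submodule A M), (∀ j : J, j.1 ≤ i → W j.1 ≤ K) → W i ≤ K := by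
    intro i K
    induction i using WellFoundedLT.induction with
    | ind i ih =>
      intro hK
      by_cases hi : V i = W i
      · rw [← hi]
        refine (stageLT_le_iff _ _).2 ⟨bot_le, fun j hj => ?_⟩
        exact (self_le_stageLE ⊥ G le_rfl).trans (ih j hj fun k hk => hK k (hk.trans hj.le))
      · exact hK ⟨i, hi⟩ le_rfl
  have hVle : ∀ i (K : Submodule A M), (∀ j : J, j.1 < i → W j.1 ≤ K) → V i ≤ K := by
    intro i K hK
    refine (stageLT_le_iff _ _).2 ⟨bot_le, fun j hj => ?_⟩
    exact (self_le_stageLE ⊥ G le_rfl).trans (hWle j K fun k hk => hK k (hk.trans_lt hj))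
  let r : J → Ordinal.{u} := fun i => Ordinal.typein (α := J) (· < ·) i
  have hr : ∀ {i j : J}, r i < r j ↔ i < j := fun {i j} =>
    Ordinal.typein_lt_typein (α := J) (· < ·)
  have hr' : ∀ {i j : J}, r i ≤ r j ↔ i ≤ j := fun {i j} => by
    rw [← not_lt, hr, not_lt]
  let σ := Ordinal.type (α := J) (· < ·)
  let F : Ordinal.{u} → Submodule A M := fun α => ⨆ i : {i : J // r i < α}, W i.1.1
  have hFle : ∀ {α} {i : J}, r i < α → W i.1 ≤ F α := fun {α i} hi =>
    le_iSup (fun i : {i : J // r i < α} => W i.1.1) ⟨i, hi⟩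
  have hFmono : ∀ α β, α ≤ β → F α ≤ F β := fun α β h => iSup_le fun i => hFle (i.2.trans_le h)
  refine ⟨σ, F, ⟨?_, ?_, fun α β h _ => hFmono α β h.le, ?_, ?_⟩⟩
  · exact le_bot_iff.1 (iSup_le fun i => absurd i.2 not_lt_zero)
  · rw [eq_top_iff, ← h, bot_sup_eq]
    refine iSup_le fun i => (self_le_stageLE ⊥ G le_rfl).trans (hWle i _ fun j _ => hFle ?_)
    exact Ordinal.typein_lt_type (α := J) (· < ·) j
  · intro α _ hα
    apply Set.Subset.antisymm
    · intro x hx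
      have hx : x ∈ F α := hx
      rcases isEmpty_or_nonempty {i : J // r i < α} with he | he
      · have : x ∈ (⊥ : Submodule A M) := by
          have h0 : F α ≤ ⊥ := iSup_le fun i => (he.false i).elim
          exact h0 hx
        simp only [Set.mem_iUnion]
        refine ⟨0, hα.bot_lt, ?_⟩
        rw [(Submodule.mem_bot A).1 this]
        exact Submodule.zero_mem _
      · rw [Submodule.mem_iSup_of_directed] at hx
        · obtain ⟨i, hi⟩ := hx
          simp only [Set.mem_iUnion]
          exact ⟨Order.succ (r i.1), hα.succ_lt i.2, hFle (Order.lt_succ _) hi⟩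
        · exact Monotone.directed_le fun a b h => stageLE_mono ⊥ G h
    · exact Set.iUnion₂_subset fun β hβ => hFmono β α hβ.le
  · intro α hα
    obtain ⟨i, rfl⟩ : ∃ i, r i = α := Ordinal.mem_range_typein_iff (α := J) (· < ·) |>.2 hα
    have h₁ : F (r i) = V i.1 := by
      apply le_antisymm
      · exact iSup_le fun j => stageLE_le_stageLT ⊥ G (hr.1 j.2)
      · exact hVle _ _ fun j hj => hFle (hr.2 hj)
    have h₂ : F (Order.succ (r i)) = W i.1 := by
      apply le_antisymm
      · exact iSup_le fun j => stageLE_mono ⊥ G (hr'.1 (Order.lt_succ_iff.1 j.2))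
      · exact hFle (Order.lt_succ _)
    rw [h₁, h₂]
    exact (hs i.1).exists_equiv i.2

theorem filtClass_iff {M : ModuleCat.{u} A} :
    FiltClass S M ↔ IsFilteredOver S (⊥ : Submodule A M) ⊤ :=
  ⟨FiltClass.isFilteredOver, filtClass_of_isFilteredOver⟩

/-- A module belongs to `𝒜` whenever it has a filtration with factors in `𝒜`. -/
def ClosedUnderFiltrations (𝒜 : ObjectProperty (ModuleCat.{u} A)) : Prop :=
  ∀ M : ModuleCat.{u} A, IsFilteredOver 𝒜 (⊥ : Submodule A M) ⊤ → 𝒜 M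

/-- An `S`-filtration of a factor is carried into the quotient by `φ` and pulled back between the
two stages, which refines the given filtration. -/
theorem closedUnderFiltrations_filtClass : ClosedUnderFiltrations (FiltClass S) := by
  intro M hM
  obtain ⟨ι, _, _, G, h, hs⟩ := hM
  rw [filtClass_iff, ← h]
  refine IsFilteredOver.of_steps _ _ fun i => ?_
  obtain h | ⟨hle, X, hX, φ, h₁, h₂⟩ := hs i
  · rw [h]; exact IsFilteredOver.refl _ _
  · have := ((filtClass_iff.1 hX).map φ (LinearMap.ker_eq_bot.2 h₁).le).comap
      (stageLT ⊥ G i).mkQ (by rw [Submodule.range_mkQ]; exact le_top)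
    rw [Submodule.map_bot, Submodule.comap_bot, Submodule.ker_mkQ, Submodule.map_top, h₂,
      Submodule.comap_map_mkQ, sup_eq_right.2 hle] at this
    exact this

/-- An isomorphism is a filtration with one step. -/
theorem ClosedUnderFiltrations.of_linearEquiv {𝒜 : ObjectProperty (ModuleCat.{u} A)}
    (h𝒜 : ClosedUnderFiltrations 𝒜) {X Y : ModuleCat.{u} A} (e : X ≃ₗ[A] Y) (hX : 𝒜 X) : 𝒜 Y := by
  refine h𝒜 Y (IsStep.isFilteredOver ?_)
  have := isStep_of_map (N := ⊥) hX e.toLinearMap (by simp)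
  simpa using this

end FiltClassLemmas

/-! ### Vanishing of Ext as a lifting property, and Eklof's lemma. -/

section Orthogonal

variable {A : Type u} [Ring A]

/-- Every map from `M` to `C` factors through `π`. -/
def LiftsAlong {E C : Type u} [AddCommGroup E] [Module A E] [AddCommGroup C] [Module A C]
    (π : E →ₗ[A] C) : ObjectProperty (ModuleCat.{u} A) :=
  fun M => ∀ g : M →ₗ[A] C, ∃ h : M →ₗ[A] E, π ∘ₗ h = g

theorem exists_extension_of_injective {E X Y : Type u} [AddCommGroup E] [Module A E]
    [Module.Injective A E] [AddCommGroup X] [Module A X] [AddCommGroup Y] [Module A Y]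
    (f : X →ₗ[A] Y) (hf : Function.Injective f) (g : X →ₗ[A] E) :
    ∃ h : Y →ₗ[A] E, h ∘ₗ f = g := by
  obtain ⟨h, hh⟩ := Module.Injective.out f hf g
  exact ⟨h, LinearMap.ext hh⟩

/-- This is Eklof's lemma: a lift of `g` is built along the filtration, and injectivity of `E`
allows a partial lift to be corrected on the next stage. -/
theorem closedUnderFiltrations_liftsAlong {E C : Type u} [AddCommGroup E] [Module A E]
    [AddCommGroup C] [Module A C] [Module.Injective A E] (π : E →ₗ[A] C) :
    ClosedUnderFiltrations (LiftsAlong π) := by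
  intro M hM g
  -- The error `g - π ∘ h` vanishes on `V`. Its restriction to the factor `W/V` lifts to `E`; the
  -- lift extends to `M/V` by injectivity and is added to `h` as the correction.
  have step : ∀ V W : Submodule A M, IsStep (LiftsAlong π) V W → ∀ h : M →ₗ[A] E,
      (∀ x ∈ V, π (h x) = g x) → ∃ h' : M →ₗ[A] E, (∀ x ∈ V, h' x = h x) ∧
        ∀ x ∈ W, π (h' x) = g x := by
    intro V W hVW h hh
    obtain rfl | ⟨hle, X, hX, φ, h₁, h₂⟩ := hVW
    · exact ⟨h, fun _ _ => rfl, hh⟩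
    let k : (M ⧸ V) →ₗ[A] C := V.liftQ (g - π ∘ₗ h) (by
      intro x hx
      simp [hh x hx])
    obtain ⟨s, hs⟩ := hX (k ∘ₗ φ)
    obtain ⟨t, ht⟩ := exists_extension_of_injective φ h₁ s
    refine ⟨h + t ∘ₗ V.mkQ, fun x hx => ?_, fun x hx => ?_⟩
    · simp [(Submodule.Quotient.mk_eq_zero V).2 hx]
    · have : V.mkQ x ∈ LinearMap.range φ := by
        rw [h₂]; exact Submodule.mem_map_of_mem hx
      obtain ⟨y, hy⟩ := this
      have e₁ : t (φ y) = s y := LinearMap.congr_fun ht y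
      have e₂ : π (s y) = k (φ y) := LinearMap.congr_fun hs y
      rw [LinearMap.add_apply, LinearMap.comp_apply, ← hy, e₁, map_add, e₂, hy]
      simp [k]
  obtain ⟨ι, _, _, G, hG, hs⟩ := hM
  -- The second condition forces the domain to be generated by an initial segment of the family, so
  -- that a maximal element stops exactly at a stage.
  let Z : Set (M →ₗ.[A] E) := {f | (∀ x : f.domain, π (f x) = g x) ∧
    f.domain ≤ ⨆ i, ⨆ (_ : ∀ j ≤ i, G j ≤ f.domain), G i}
  obtain ⟨m, -, hm⟩ := zorn_le_nonempty₀ Z (by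
    intro c hc hchain y hy
    refine ⟨LinearPMap.sSup c hchain.directedOn, ⟨?_, ?_⟩,
      fun z hz => LinearPMap.le_sSup hchain.directedOn hz⟩
    · rintro ⟨x, hx⟩
      obtain ⟨f, hf, hxf⟩ := (LinearPMap.mem_domain_sSup_iff ⟨y, hy⟩ hchain.directedOn).1 hx
      have := LinearPMap.sSup_apply hchain.directedOn hf ⟨x, hxf⟩
      rw [this]
      exact (hc hf).1 ⟨x, hxf⟩
    · intro x hx
      obtain ⟨f, hf, hxf⟩ := (LinearPMap.mem_domain_sSup_iff ⟨y, hy⟩ hchain.directedOn).1 hx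
      have hle := (LinearPMap.le_sSup hchain.directedOn hf).1
      refine (iSup₂_le fun i hi => ?_ : (⨆ i, ⨆ (_ : ∀ j ≤ i, G j ≤ f.domain), G i) ≤ _)
        ((hc hf).2 hxf)
      exact le_iSup₂ (f := fun i (_ : ∀ j ≤ i, G j ≤ (LinearPMap.sSup c hchain.directedOn).domain) =>
        G i) i (fun j hj => (hi j hj).trans hle)) ⊥ (by
    refine ⟨?_, ?_⟩
    · rintro ⟨x, hx⟩
      have hx0 : x = 0 := (Submodule.mem_bot A).1 hx
      subst hx0
      have : (⟨0, hx⟩ : (⊥ : M →ₗ.[A] E).domain) = 0 := rfl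
      rw [this]
      simp
    · exact bot_le)
  have hall : ∀ i, G i ≤ m.domain := by
    intro i
    induction i using WellFoundedLT.induction with
    | ind i ih =>
      by_contra hi
      have hdom : stageLT ⊥ G i = m.domain := by
        apply le_antisymm
        · exact (stageLT_le_iff _ _).2 ⟨bot_le, ih⟩
        · refine hm.1.2.trans (iSup₂_le fun k hk => self_le_stageLT ⊥ G ?_)
          by_contra hki
          exact hi (hk i (not_lt.1 hki))
      obtain ⟨h, hh⟩ := exists_extension_of_injective m.domain.subtype
        m.domain.injective_subtype m.toFun
      have hh' : ∀ x : m.domain, h x = m x := fun x => LinearMap.congr_fun hh x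
      obtain ⟨h', h₁, h₂⟩ := step _ _ (hs i) h (by
        intro x hx
        rw [hdom] at hx
        rw [hh' ⟨x, hx⟩]
        exact hm.1.1 ⟨x, hx⟩)
      let f : M →ₗ.[A] E := ⟨stageLE ⊥ G i, h'.domRestrict _⟩
      have hmf : m ≤ f := by
        refine ⟨hdom.ge.trans (stageLT_le_stageLE ⊥ G i), ?_⟩
        rintro ⟨x, hx⟩ ⟨y, hy⟩ (rfl : x = y)
        have : h' x = h x := h₁ x (by rw [hdom]; exact hx)
        exact ((this.trans (hh' ⟨x, hx⟩))).symm
      have hf : f ∈ Z := by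
        refine ⟨fun x => h₂ x x.2, ?_⟩
        refine (stageLE_le_iff _ _).2 ⟨bot_le, fun j hj => ?_⟩
        exact le_iSup₂ (f := fun i (_ : ∀ j ≤ i, G j ≤ f.domain) => G i) j
          (fun k hk => self_le_stageLE ⊥ G (hk.trans hj))
      exact hi ((self_le_stageLE ⊥ G le_rfl).trans (hm.2 hf hmf).1)
  have htop : m.domain = ⊤ := by
    rw [eq_top_iff, ← hG, bot_sup_eq]
    exact iSup_le hall
  refine ⟨m.toFun ∘ₗ (LinearEquiv.ofTop _ htop).symm.toLinearMap, ?_⟩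
  ext x
  exact hm.1.1 _

/-- In the long exact sequence `Ext¹(M, S.X₂)` vanishes, so `Ext¹(M, S.X₁)` is the cokernel of
composition with `S.g`. -/
theorem subsingleton_ext_one_iff {S : ShortComplex (ModuleCat.{u} A)} (hS : S.ShortExact)
    [Injective S.X₂] (M : ModuleCat.{u} A) :
    Subsingleton (Abelian.Ext.{u} M S.X₁ 1) ↔ LiftsAlong S.g.hom M := by
  constructor
  · intro hM g
    obtain ⟨x, hx⟩ := Abelian.Ext.covariant_sequence_exact₃ M hS (n₁ := 1)
      (Abelian.Ext.mk₀ (ModuleCat.ofHom g)) rfl (Subsingleton.elim _ _)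
    obtain ⟨h, rfl⟩ := (Abelian.Ext.mk₀_bijective _ _).2 x
    rw [Abelian.Ext.mk₀_comp_mk₀] at hx
    have := (Abelian.Ext.mk₀_bijective _ _).1 hx
    exact ⟨h.hom, congrArg ModuleCat.Hom.hom this⟩
  · intro hM
    refine subsingleton_of_forall_eq 0 fun x => ?_
    obtain ⟨y, rfl⟩ := Abelian.Ext.covariant_sequence_exact₁ M hS x
      (Abelian.Ext.eq_zero_of_injective _) (zero_add 1)
    obtain ⟨g, rfl⟩ := (Abelian.Ext.mk₀_bijective _ _).2 y
    obtain ⟨h, hh⟩ := hM g.hom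
    have : g = ModuleCat.ofHom h ≫ S.g := ModuleCat.hom_ext hh.symm
    rw [this, ← Abelian.Ext.mk₀_comp_mk₀, Abelian.Ext.comp_assoc_of_second_deg_zero,
      hS.comp_extClass, Abelian.Ext.comp_zero]

/-- Vanishing of `Ext¹(-, B)` is a lifting property against a map out of an injective module. -/
theorem exists_liftsAlong_iff (B : ModuleCat.{u} A) :
    ∃ (E C : ModuleCat.{u} A) (π : E →ₗ[A] C), Module.Injective A E ∧
      Nonempty (LinearMap.ker π ≃ B) ∧
      ∀ M : ModuleCat.{u} A, Subsingleton (Abelian.Ext.{u} M B 1) ↔ LiftsAlong π M := by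
  obtain ⟨J⟩ := EnoughInjectives.presentation B
  obtain ⟨E, hE, f, hf⟩ := J
  have hinj := (ModuleCat.mono_iff_injective f).1 hf
  let S : ShortComplex (ModuleCat.{u} A) :=
    ShortComplex.mk f (ModuleCat.ofHom (LinearMap.range f.hom).mkQ) (by
      ext x; simp)
  have hS : S.ShortExact := by
    refine ModuleCat.shortComplex_shortExact S ?_ hinj (Submodule.mkQ_surjective _)
    intro x
    change (LinearMap.range f.hom).mkQ x = 0 ↔ ∃ y, f.hom y = x
    simp
  have : Injective S.X₂ := hE
  refine ⟨E, _, S.g.hom, ?_, ?_, subsingleton_ext_one_iff hS⟩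
  · have : Injective (ModuleCat.of A E) := hE
    exact Module.injective_module_of_injective_object A E
  · have : LinearMap.ker S.g.hom = LinearMap.range f.hom := Submodule.ker_mkQ _
    rw [this]
    exact ⟨(LinearEquiv.ofInjective f.hom hinj).symm.toEquiv⟩

theorem closedUnderFiltrations_leftExtOrthogonal (ℬ : ObjectProperty (ModuleCat.{u} A)) :
    ClosedUnderFiltrations (leftExtOrthogonal ℬ) := by
  intro M hM N hN
  obtain ⟨E, C, π, hE, -, hπ⟩ := exists_liftsAlong_iff N
  rw [hπ]
  refine closedUnderFiltrations_liftsAlong π M ?_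
  obtain ⟨ι, i₁, i₂, G, h, hs⟩ := hM
  refine ⟨ι, i₁, i₂, G, h, fun i => ?_⟩
  obtain h | ⟨hle, X, hX, φ, h₁⟩ := hs i
  · exact Or.inl h
  · exact Or.inr ⟨hle, X, (hπ X).1 (hX N hN), φ, h₁⟩

end Orthogonal

/-! ### Direct limits of modules in terms of elements. -/

section ElementwiseColimits

variable {A : Type u} [Ring A] {K : Type u} [PartialOrder K] [IsDirectedOrder K] [Nonempty K]
  {F : K ⥤ ModuleCat.{u} A} {c : Cocone F}

theorem exists_rep_of_isColimit (hc : IsColimit c) (z : c.pt) :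
    ∃ (k : K) (x : F.obj k), (c.ι.app k).hom x = z :=
  Concrete.isColimit_exists_rep F hc z

theorem exists_map_eq_zero_of_isColimit (hc : IsColimit c) {k : K} {x : F.obj k}
    (hx : (c.ι.app k).hom x = 0) : ∃ (j : K) (h : k ≤ j), (F.map (homOfLE h)).hom x = 0 := by
  obtain ⟨j, f, hj⟩ := (hc.eq_iff' x 0).1 (by
    change (c.ι.app k).hom x = (c.ι.app k).hom 0
    rw [hx, map_zero])
  refine ⟨j, leOfHom f, ?_⟩
  have : (F.map f).hom x = (F.map f).hom 0 := hj
  rw [map_zero] at this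
  exact this

/-- The two conditions are surjectivity and injectivity of the comparison map from the colimit. -/
theorem nonempty_isColimit_of_elementwise
    (h₁ : ∀ z : c.pt, ∃ (k : K) (x : F.obj k), (c.ι.app k).hom x = z)
    (h₂ : ∀ (k : K) (x : F.obj k), (c.ι.app k).hom x = 0 →
      ∃ (j : K) (h : k ≤ j), (F.map (homOfLE h)).hom x = 0) : Nonempty (IsColimit c) := by
  let d := (colimit.isColimit F).desc c
  have hd : ∀ k (x : F.obj k), d.hom ((colimit.ι F k).hom x) = (c.ι.app k).hom x := fun k x =>
    LinearMap.congr_fun (congrArg ModuleCat.Hom.hom ((colimit.isColimit F).fac c k)) x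
  have hbij : Function.Bijective d.hom := by
    constructor
    · rw [← LinearMap.ker_eq_bot, LinearMap.ker_eq_bot']
      intro z hz
      obtain ⟨k, x, rfl⟩ := exists_rep_of_isColimit (colimit.isColimit F) z
      have hz' := hd k x
      obtain ⟨j, h, hj⟩ := h₂ k x (hz'.symm.trans hz)
      have := LinearMap.congr_fun (congrArg ModuleCat.Hom.hom (colimit.w F (homOfLE h))) x
      have h0 : (colimit.ι F j).hom ((F.map (homOfLE h)).hom x) = 0 := by rw [hj, map_zero]
      exact this.symm.trans h0
    · intro z
      obtain ⟨k, x, rfl⟩ := h₁ z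
      exact ⟨_, hd k x⟩
  have : IsIso d := (ConcreteCategory.isIso_iff_bijective d).2 hbij
  exact ⟨IsColimit.ofPointIso (colimit.isColimit F)⟩

theorem map_map_apply {K : Type u} [PartialOrder K] (F : K ⥤ ModuleCat.{u} A) {i j k : K}
    (h : i ≤ j) (h' : j ≤ k) (x : F.obj i) :
    (F.map (homOfLE h')).hom ((F.map (homOfLE h)).hom x) =
      (F.map (homOfLE (h.trans h'))).hom x := by
  rw [← homOfLE_comp h h', F.map_comp]
  rfl

theorem map_refl_apply {K : Type u} [PartialOrder K] (F : K ⥤ ModuleCat.{u} A) {i : K}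
    (h : i ≤ i) (x : F.obj i) : (F.map (homOfLE h)).hom x = x :=
  LinearMap.congr_fun (congrArg ModuleCat.Hom.hom (F.map_id i)) x

theorem cocone_w_apply {K : Type u} [PartialOrder K] {F : K ⥤ ModuleCat.{u} A} (c : Cocone F)
    {i j : K} (h : i ≤ j) (x : F.obj i) :
    (c.ι.app j).hom ((F.map (homOfLE h)).hom x) = (c.ι.app i).hom x :=
  LinearMap.congr_fun (congrArg ModuleCat.Hom.hom (c.w (homOfLE h))) x

end ElementwiseColimits

/-! ### Adjoining one branch to a submodule. -/

section Branch

variable {A : Type u} [Ring A] {Λ : Type u} [LinearOrder Λ]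
  {C : Λ ⥤ ModuleCat.{u} A} {𝒜 : ObjectProperty (ModuleCat.{u} A)}
  {P : Type u} [AddCommGroup P] [Module A P] {N : Submodule A P}
  {b : ∀ α : Λ, C.obj α →ₗ[A] P} {ev : ∀ β : Λ, P →ₗ[A] C.obj β} {γ : Λ}

/-- Generators that start at or below level `β` are transported by the maps of `C` from there on, so
the value at `β` determines all later ones. -/
theorem eval_eq_map_eval
    (hev : ∀ {α β : Λ} (h : α ≤ β) (x), ev β (b α x) = (C.map (homOfLE h)).hom x)
    {β β' : Λ} (h : β ≤ β') {w : P}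
    (hw : w ∈ stageLE ⊥ (fun α => LinearMap.range (b α)) β) :
    ev β' w = (C.map (homOfLE h)).hom (ev β w) := by
  have : stageLE ⊥ (fun α => LinearMap.range (b α)) β ≤
      LinearMap.eqLocus (ev β') ((C.map (homOfLE h)).hom ∘ₗ ev β) := by
    refine (stageLE_le_iff _ _).2 ⟨bot_le, ?_⟩
    rintro α hα _ ⟨x, rfl⟩
    rw [LinearMap.mem_eqLocus, LinearMap.comp_apply, hev hα, hev (hα.trans h), map_map_apply]
  exact this hw

/-- Modulo `N` the maps `b α` below `γ` are compatible and induce a map from the direct limit. If `b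
α x` lies in `N`, its values along the branch vanish at some level below `γ`; these values are the
images of `x`, so `x` dies in the limit. -/
theorem isStep_limit_branch
    (hev : ∀ {α β : Λ} (h : α ≤ β) (x), ev β (b α x) = (C.map (homOfLE h)).hom x)
    (hne : (Set.Iio γ).Nonempty)
    (hcoh : ∀ {α β : Λ} (h : α ≤ β) (x), β < γ → b α x - b β ((C.map (homOfLE h)).hom x) ∈ N)
    (hfin : ∀ g ∈ N, ∃ β₀ < γ, ∀ β, β₀ ≤ β → β < γ → ev β g = 0)
    (c : Cocone (subsystem C (Set.Iio γ))) (hc : IsColimit c) (hA : 𝒜 c.pt) :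
    IsStep 𝒜 N (stageLT N (fun α => LinearMap.range (b α)) γ) := by
  have : Nonempty (Set.Iio γ) := hne.to_subtype
  let d : Cocone (subsystem C (Set.Iio γ)) :=
    { pt := ModuleCat.of A (P ⧸ N)
      ι :=
        { app := fun α => ModuleCat.ofHom (N.mkQ ∘ₗ b α.1)
          naturality := fun α β f => by
            ext x
            have := hcoh (leOfHom f) x β.2
            rw [← Submodule.Quotient.mk_eq_zero, Submodule.Quotient.mk_sub, sub_eq_zero] at this
            exact this.symm } }
  have hd : ∀ α (x : (subsystem C (Set.Iio γ)).obj α),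
      (hc.desc d).hom ((c.ι.app α).hom x) = N.mkQ (b α.1 x) := fun α x =>
    LinearMap.congr_fun (congrArg ModuleCat.Hom.hom (hc.fac d α)) x
  refine Or.inr ⟨le_stageLT _ _ _, c.pt, hA, (hc.desc d).hom, ?_, ?_⟩
  · rw [← LinearMap.ker_eq_bot, LinearMap.ker_eq_bot']
    intro z hz
    obtain ⟨α, x, rfl⟩ := exists_rep_of_isColimit hc z
    have hx : b α.1 x ∈ N := (Submodule.Quotient.mk_eq_zero N).1 ((hd α x).symm.trans hz)
    obtain ⟨β₀, hβ₀, h⟩ := hfin _ hx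
    have hβ : max α.1 β₀ < γ := max_lt α.2 hβ₀
    have h0 := h (max α.1 β₀) (le_max_right _ _) hβ
    have h0' := (hev (le_max_left α.1 β₀) x).symm.trans h0
    have h1 := cocone_w_apply c (i := α) (j := ⟨max α.1 β₀, hβ⟩) (le_max_left α.1 β₀) x
    rw [← h1]
    exact (congrArg (c.ι.app ⟨max α.1 β₀, hβ⟩).hom h0').trans (map_zero _)
  · apply le_antisymm
    · rintro _ ⟨z, rfl⟩
      obtain ⟨α, x, rfl⟩ := exists_rep_of_isColimit hc z
      refine ⟨b α.1 x, ?_, (hd α x).symm⟩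
      exact self_le_stageLT N (fun α => LinearMap.range (b α)) α.2 ⟨x, rfl⟩
    · rw [Submodule.map_le_iff_le_comap]
      refine (stageLT_le_iff _ _).2 ⟨fun x hx => ?_, ?_⟩
      · rw [Submodule.mem_comap, Submodule.mkQ_apply, (Submodule.Quotient.mk_eq_zero N).2 hx]
        exact Submodule.zero_mem _
      · rintro α hα _ ⟨x, rfl⟩
        exact ⟨_, hd ⟨α, hα⟩ x⟩

/-- Adjoining to `N` all the images of the maps `b α` along one branch. Below the level `γ` the
branch is either glued to `N` through the level `γ`, or its images modulo `N` have the direct limit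
of the system below `γ` as their union; from `γ` on it is free over `N`. -/
theorem isFilteredOver_branch [WellFoundedLT Λ] (hC : ∀ α, 𝒜 (C.obj α))
    (hlim : (Set.Iio γ).Nonempty → ∃ c : Cocone (subsystem C (Set.Iio γ)),
      Nonempty (IsColimit c) ∧ 𝒜 c.pt)
    (hev : ∀ {α β : Λ} (h : α ≤ β) (x), ev β (b α x) = (C.map (homOfLE h)).hom x)
    (hev₀ : ∀ {α β : Λ} (_ : β < α) (x), ev β (b α x) = 0)
    (hN : ∀ β, γ ≤ β → ∀ g ∈ N, ev β g = 0)
    (hcase : (∀ {α : Λ} (h : α < γ) (x), b α x - b γ ((C.map (homOfLE h.le)).hom x) ∈ N) ∨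
      ((Set.Iio γ).Nonempty ∧
        (∀ {α β : Λ} (h : α ≤ β) (x), β < γ → b α x - b β ((C.map (homOfLE h)).hom x) ∈ N) ∧
        ∀ g ∈ N, ∃ β₀ < γ, ∀ β, β₀ ≤ β → β < γ → ev β g = 0)) :
    IsFilteredOver 𝒜 N (N ⊔ ⨆ α, LinearMap.range (b α)) := by
  -- Write `b α x = n + w`. At level `β < α` both `b α x` and `n` vanish, hence so does `w`, and
  -- then also its value at `α`; as `n` vanishes at `α`, that value is `x`.
  have hfree : ∀ (α : Λ), γ ≤ α → ∀ (N₁ : Submodule A P), (∀ g ∈ N₁, ∃ n ∈ N, ∃ β < α,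
      g - n ∈ stageLE ⊥ (fun α => LinearMap.range (b α)) β ∧ ev β n = 0) →
      ∀ x, b α x ∈ N₁ → x = 0 := by
    intro α hα N₁ hN₁ x hx
    obtain ⟨n, hn, β, hβ, hw, hβn⟩ := hN₁ _ hx
    have h₁ := eval_eq_map_eval hev hβ.le hw
    rw [map_sub, map_sub, hev₀ hβ, hβn, hN α hα n hn, hev le_rfl, sub_zero, sub_zero, map_zero,
      map_refl_apply] at h₁
    exact h₁
  -- Levels from `γ` on contribute the factors `C α`. The base `N₁` is `N` in the glued case, and
  -- `N` with all images below `γ` in the limit case.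
  have second : ∀ N₁ : Submodule A P, N ≤ N₁ → N₁ ≤ N ⊔ ⨆ α, LinearMap.range (b α) →
      (∀ {α : Λ} (_ : α < γ), LinearMap.range (b α) ≤ N₁ ⊔ LinearMap.range (b γ)) →
      (∀ α, γ ≤ α → ∀ x, b α x ∈ N₁ → x = 0) →
      (∀ g ∈ N₁, ∃ n ∈ N, g - n ∈ stageLE ⊥ (fun α => LinearMap.range (b α)) γ) →
      IsFilteredOver 𝒜 N₁ (N ⊔ ⨆ α, LinearMap.range (b α)) := by
    intro N₁ h₀ h₁ h₂ h₃ h₄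
    have := isFilteredOver_of_maps (ι := Set.Ici γ) N₁ (fun α => C.obj α.1) (fun α => hC α.1)
      (fun α => b α.1) (fun α x hx => ?_)
    · convert this using 1
      apply le_antisymm
      · refine sup_le (h₀.trans le_sup_left) (iSup_le fun α => ?_)
        rcases lt_or_ge α γ with h | h
        · refine (h₂ h).trans (sup_le_sup_left ?_ _)
          exact le_iSup (fun α : Set.Ici γ => LinearMap.range (b α.1)) ⟨γ, le_rfl⟩
        · exact (le_iSup (fun α : Set.Ici γ => LinearMap.range (b α.1)) ⟨α, h⟩).trans le_sup_right
      · refine sup_le h₁ (iSup_le fun α => ?_)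
        exact (le_iSup (fun α => LinearMap.range (b α)) α.1).trans le_sup_right
    · rcases (mem_stageLT_iff _ _).1 hx with hx | ⟨j, hj, hx⟩
      · exact h₃ α.1 α.2 x hx
      · refine hfree α.1 α.2 _ (fun g hg => ?_) x hx
        obtain ⟨n₁, hn₁, w, hw, rfl⟩ := Submodule.mem_sup.1 hg
        obtain ⟨n, hn, hnw⟩ := h₄ n₁ hn₁
        refine ⟨n, hn, j.1, hj, ?_, hN _ j.2 n hn⟩
        rw [add_sub_right_comm]
        refine Submodule.add_mem _ (stageLE_mono _ _ j.2 hnw) ?_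
        refine (iSup₂_le ?_ : _ ≤ stageLE ⊥ (fun α => LinearMap.range (b α)) j.1) hw
        intro k hk
        exact self_le_stageLE ⊥ (fun α => LinearMap.range (b α)) hk
  rcases hcase with hglue | ⟨hne, hcoh, hfin⟩
  · refine second N le_rfl le_sup_left ?_ ?_ ?_
    · rintro α hα _ ⟨x, rfl⟩
      rw [← sub_add_cancel (b α x) (b γ ((C.map (homOfLE hα.le)).hom x))]
      exact Submodule.add_mem_sup (hglue hα x) ⟨_, rfl⟩
    · intro α hα x hx
      have := hN α hα _ hx
      rw [hev le_rfl, map_refl_apply] at this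
      exact this
    · intro g hg
      exact ⟨g, hg, by rw [sub_self]; exact Submodule.zero_mem _⟩
  · obtain ⟨c, ⟨hc⟩, hA⟩ := hlim hne
    refine (isStep_limit_branch hev hne hcoh hfin c hc hA).isFilteredOver.trans ?_
    have hdec : ∀ g ∈ stageLT N (fun α => LinearMap.range (b α)) γ, ∃ n ∈ N,
        g - n ∈ stageLT ⊥ (fun α => LinearMap.range (b α)) γ := by
      intro g hg
      obtain ⟨n, hn, w, hw, rfl⟩ := Submodule.mem_sup.1 hg
      refine ⟨n, hn, ?_⟩
      rw [add_sub_cancel_left]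
      exact Submodule.mem_sup_right hw
    refine second _ (le_stageLT _ _ _) ?_ ?_ ?_ ?_
    · exact (stageLT_le_iff _ _).2 ⟨le_sup_left, fun α _ =>
        le_sup_of_le_right (le_iSup (fun α => LinearMap.range (b α)) α)⟩
    · intro α hα
      exact le_sup_of_le_left (self_le_stageLT N (fun α => LinearMap.range (b α)) hα)
    · intro α hα x hx
      refine hfree α hα _ (fun g hg => ?_) x hx
      obtain ⟨n, hn, hw⟩ := hdec g hg
      obtain ⟨β₀, hβ₀, h⟩ := hfin n hn
      rcases (mem_stageLT_iff _ _).1 hw with h0 | ⟨β, hβ, hw⟩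
      · refine ⟨n, hn, β₀, hβ₀.trans_le hα, ?_, h β₀ le_rfl hβ₀⟩
        rw [(Submodule.mem_bot A).1 h0]
        exact Submodule.zero_mem _
      · have hm : max β β₀ < γ := max_lt hβ hβ₀
        exact ⟨n, hn, max β β₀, hm.trans_le hα, stageLE_mono _ _ (le_max_left _ _) hw,
          h _ (le_max_right _ _) hm⟩
    · intro g hg
      obtain ⟨n, hn, hw⟩ := hdec g hg
      exact ⟨n, hn, stageLT_le_stageLE _ _ _ hw⟩

end Branch

/-! ### The tree module and its spans of branches. -/

section TreeModule

open Classical in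
/-- The map sending `x` to the function on the nodes of a tree whose value at the node of level
`β ≥ α` of the branch `E` is the image of `x`, and which vanishes at all other nodes. -/
noncomputable def branchMap {A : Type u} [Ring A] {Λ : Type u} [LinearOrder Λ]
    (C : Λ ⥤ ModuleCat.{u} A) {H T : Type u} (p : Λ → H → T) (E : H) (α : Λ) :
    C.obj α →ₗ[A] (∀ β : Λ, T → C.obj β) :=
  LinearMap.pi fun β => LinearMap.pi fun t =>
    if h : α ≤ β ∧ p β E = t then (C.map (homOfLE h.1)).hom else 0

variable {A : Type u} [Ring A] {Λ : Type u} [LinearOrder Λ]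
  {C : Λ ⥤ ModuleCat.{u} A} {H T : Type u} {p : Λ → H → T}

theorem branchMap_apply_of_eq {E : H} {α β : Λ} {t : T} (h : α ≤ β) (ht : p β E = t)
    (x : C.obj α) : branchMap C p E α x β t = (C.map (homOfLE h)).hom x := by
  simp [branchMap, h, ht]

theorem branchMap_apply_of_ne {E : H} {α β : Λ} {t : T} (ht : p β E ≠ t)
    (x : C.obj α) : branchMap C p E α x β t = 0 := by
  simp [branchMap, ht]

theorem branchMap_apply_of_lt {E : H} {α β : Λ} {t : T} (h : β < α)
    (x : C.obj α) : branchMap C p E α x β t = 0 := by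
  simp [branchMap, h.not_ge]

/-- The part of a branch element between two levels depends only on the nodes between them. -/
theorem branchMap_segment_eq {E E' : H} {α α' : Λ} (h : α ≤ α') (x : C.obj α)
    (hE : ∀ β < α', p β E = p β E') :
    branchMap C p E α x - branchMap C p E α' ((C.map (homOfLE h)).hom x) =
      branchMap C p E' α x - branchMap C p E' α' ((C.map (homOfLE h)).hom x) := by
  have aux : ∀ (E : H) (β : Λ) (t : T), α' ≤ β → branchMap C p E α x β t -
      branchMap C p E α' ((C.map (homOfLE h)).hom x) β t = 0 := by
    intro E β t hβ
    by_cases ht : p β E = t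
    · rw [branchMap_apply_of_eq (h.trans hβ) ht, branchMap_apply_of_eq hβ ht, map_map_apply,
        sub_self]
    · rw [branchMap_apply_of_ne ht, branchMap_apply_of_ne ht, sub_self]
  funext β t
  simp only [Pi.sub_apply]
  rcases lt_or_ge β α' with hβ | hβ
  · rw [branchMap_apply_of_lt hβ, branchMap_apply_of_lt hβ]
    congr 1
    rcases lt_or_ge β α with hα | hα
    · rw [branchMap_apply_of_lt hα, branchMap_apply_of_lt hα]
    · by_cases ht : p β E = t
      · rw [branchMap_apply_of_eq hα ht, branchMap_apply_of_eq hα ((hE β hβ).symm.trans ht)]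
      · rw [branchMap_apply_of_ne ht, branchMap_apply_of_ne (fun h => ht ((hE β hβ).trans h))]
  · rw [aux E β t hβ, aux E' β t hβ]

variable (C p) in
/-- The submodule generated by the elements lying on the branches in `X`. -/
noncomputable def branchSpan (X : Set H) : Submodule A (∀ β : Λ, T → C.obj β) :=
  ⨆ E : X, ⨆ α, LinearMap.range (branchMap C p E.1 α)

theorem branchMap_mem_branchSpan {X : Set H} {E : H} (hE : E ∈ X) {α : Λ} (x : C.obj α) :
    branchMap C p E α x ∈ branchSpan C p X :=
  Submodule.mem_iSup_of_mem (⟨E, hE⟩ : X) (Submodule.mem_iSup_of_mem α ⟨x, rfl⟩)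

theorem branchSpan_le {X : Set H} {K : Submodule A (∀ β : Λ, T → C.obj β)}
    (h : ∀ E ∈ X, ∀ α (x : C.obj α), branchMap C p E α x ∈ K) : branchSpan C p X ≤ K := by
  refine iSup_le fun E => iSup_le fun α => ?_
  rintro _ ⟨x, rfl⟩
  exact h E.1 E.2 α x

theorem branchSpan_mono {X Y : Set H} (h : X ⊆ Y) : branchSpan C p X ≤ branchSpan C p Y :=
  branchSpan_le fun _ hE _ x => branchMap_mem_branchSpan (h hE) x

variable {𝒜 : ObjectProperty (ModuleCat.{u} A)}

/-- The branches are adjoined in the order of `Λ`; `hbdd` guarantees a level at which a new branch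
has left all its predecessors. -/
theorem isFilteredOver_branchSpan [WellFoundedLT Λ]
    (hp : ∀ {α β : Λ} {E E' : H}, α ≤ β → p β E = p β E' → p α E = p α E')
    (hsep : ∀ {E E' : H}, E ≠ E' → ∃ β, p β E ≠ p β E')
    (hbdd : ∀ (i : Λ) (f : Set.Iio i → Λ), ∃ β, ∀ j, f j ≤ β)
    (hC : ∀ α, 𝒜 (C.obj α))
    (hlim : ∀ γ : Λ, (Set.Iio γ).Nonempty → ∃ c : Cocone (subsystem C (Set.Iio γ)),
      Nonempty (IsColimit c) ∧ 𝒜 c.pt)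
    (e : Λ → H) : IsFilteredOver 𝒜 ⊥ (branchSpan C p (Set.range e)) := by
  let G : Λ → Submodule A (∀ β : Λ, T → C.obj β) := fun i =>
    ⨆ α, LinearMap.range (branchMap C p (e i) α)
  have hG : ∀ {i α} (x : C.obj α), branchMap C p (e i) α x ∈ G i := fun {i α} x =>
    Submodule.mem_iSup_of_mem α ⟨x, rfl⟩
  have hspan : branchSpan C p (Set.range e) = ⊥ ⊔ ⨆ i, G i := by
    rw [bot_sup_eq]
    apply le_antisymm
    · refine branchSpan_le ?_
      rintro _ ⟨i, rfl⟩ α x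
      exact Submodule.mem_iSup_of_mem i (hG x)
    · refine iSup_le fun i => iSup_le fun α => ?_
      rintro _ ⟨x, rfl⟩
      exact branchMap_mem_branchSpan (Set.mem_range_self i) x
  rw [hspan]
  refine IsFilteredOver.of_steps _ _ fun i => ?_
  have hmem : ∀ {j}, j < i → ∀ {α} (x : C.obj α), branchMap C p (e j) α x ∈ stageLT ⊥ G i :=
    fun hj _ x => self_le_stageLT ⊥ G hj (hG x)
  have hNle : ∀ K : Submodule A (∀ β : Λ, T → C.obj β),
      (∀ j < i, ∀ α (x : C.obj α), branchMap C p (e j) α x ∈ K) → stageLT ⊥ G i ≤ K := by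
    intro K hK
    refine (stageLT_le_iff _ _).2 ⟨bot_le, fun j hj => iSup_le fun α => ?_⟩
    rintro _ ⟨x, rfl⟩
    exact hK j hj α x
  rw [stageLE_eq]
  -- The enumeration may repeat branches; a repeated one adds nothing.
  by_cases hrep : ∃ j < i, e i = e j
  · obtain ⟨j, hj, hij⟩ := hrep
    have : G i = G j := by simp only [G, hij]
    rw [this, sup_eq_left.2 (self_le_stageLT ⊥ G hj)]
    exact IsFilteredOver.refl _ _
  have hne : ∀ j : Set.Iio i, ∃ β, p β (e i) ≠ p β (e j.1) := fun j =>
    hsep fun h => hrep ⟨j.1, j.2, h⟩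
  choose f hf using hne
  obtain ⟨β₁, hβ₁⟩ := hbdd i f
  have hS : {β | ∀ j < i, p β (e i) ≠ p β (e j)}.Nonempty :=
    ⟨β₁, fun j hj h => hf ⟨j, hj⟩ (hp (hβ₁ ⟨j, hj⟩) h)⟩
  -- `γ` is the first level whose node lies on no earlier branch.
  let γ := wellFounded_lt.min {β | ∀ j < i, p β (e i) ≠ p β (e j)} hS
  have hγ : ∀ β, γ ≤ β → ∀ j < i, p β (e i) ≠ p β (e j) := fun β hβ j hj h =>
    wellFounded_lt.min_mem _ hS j hj (hp hβ h)
  have hγ' : ∀ β < γ, ∃ j < i, p β (e i) = p β (e j) := by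
    intro β hβ
    by_contra hcon
    push Not at hcon
    exact wellFounded_lt.not_lt_min {β | ∀ j < i, p β (e i) ≠ p β (e j)} hcon hβ
  let ev : ∀ β : Λ, (∀ β : Λ, T → C.obj β) →ₗ[A] C.obj β := fun β =>
    LinearMap.proj (p β (e i)) ∘ₗ LinearMap.proj β
  refine isFilteredOver_branch (ev := ev) (γ := γ) hC (hlim γ)
    (fun h x => branchMap_apply_of_eq h rfl x) (fun h x => branchMap_apply_of_lt h x) ?_ ?_
  · intro β hβ g hg
    have : stageLT ⊥ G i ≤ LinearMap.ker (ev β) := hNle _ fun j hj α x =>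
      branchMap_apply_of_ne (hγ β hβ j hj).symm x
    exact this hg
  -- If one earlier branch shares every node below `γ`, the segments below `γ` already lie in `N`.
  -- Otherwise every earlier branch separates before `γ`, which is the limit case.
  by_cases hglue : ∃ j < i, ∀ β < γ, p β (e i) = p β (e j)
  · left
    obtain ⟨j, hj, hji⟩ := hglue
    intro α h x
    rw [branchMap_segment_eq h.le x hji]
    exact Submodule.sub_mem _ (hmem hj _) (hmem hj _)
  rcases Set.eq_empty_or_nonempty (Set.Iio γ) with hem | hnem
  · left
    intro α h x
    have : α ∈ Set.Iio γ := h
    rw [hem] at this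
    exact this.elim
  right
  refine ⟨hnem, ?_, ?_⟩
  · intro α β h x hβ
    obtain ⟨j, hj, hji⟩ := hγ' β hβ
    rw [branchMap_segment_eq h x fun β' hβ' => hp hβ'.le hji]
    exact Submodule.sub_mem _ (hmem hj _) (hmem hj _)
  -- `K` consists of the functions that vanish along the new branch from some level below `γ` up to
  -- `γ`.
  · let K : Submodule A (∀ β : Λ, T → C.obj β) :=
      { carrier := {g | ∃ β₀ < γ, ∀ β, β₀ ≤ β → β < γ → ev β g = 0}
        add_mem' := by
          rintro g g' ⟨β₀, h₀, h⟩ ⟨β₀', h₀', h'⟩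
          refine ⟨max β₀ β₀', max_lt h₀ h₀', fun β hβ hβγ => ?_⟩
          rw [map_add, h β ((le_max_left _ _).trans hβ) hβγ,
            h' β ((le_max_right _ _).trans hβ) hβγ, add_zero]
        zero_mem' := ⟨hnem.some, hnem.some_mem, fun β _ _ => map_zero _⟩
        smul_mem' := by
          rintro r g ⟨β₀, h₀, h⟩
          refine ⟨β₀, h₀, fun β hβ hβγ => ?_⟩
          rw [map_smul, h β hβ hβγ, smul_zero] }
    have hK : stageLT ⊥ G i ≤ K := by
      refine hNle _ fun j hj α x => ?_
      push Not at hglue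
      obtain ⟨β₀, h₀, h⟩ := hglue j hj
      exact ⟨β₀, h₀, fun β hβ _ =>
        branchMap_apply_of_ne (fun h' => h (hp hβ h'.symm)) x⟩
    exact fun g hg => hK hg

/-- A submodule filtered over `𝒜`, as a module, belongs to `𝒜`. -/
theorem ClosedUnderFiltrations.of_submodule (h𝒜 : ClosedUnderFiltrations 𝒜) {P : Type u}
    [AddCommGroup P] [Module A P] {N : Submodule A P} (h : IsFilteredOver 𝒜 ⊥ N) :
    𝒜 (ModuleCat.of A N) := by
  refine h𝒜 _ ?_
  have := h.comap N.subtype (by rw [Submodule.range_subtype])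
  rwa [Submodule.comap_bot, Submodule.ker_subtype, Submodule.comap_subtype_self] at this

/-- The directed system of submodules given by a monotone map, with the inclusions. -/
noncomputable def submoduleSystem {P : Type u} [AddCommGroup P] [Module A P] {K : Type u}
    [PartialOrder K] (V : K →o Submodule A P) : K ⥤ ModuleCat.{u} A where
  obj k := ModuleCat.of A (V k)
  map f := ModuleCat.ofHom (Submodule.inclusion (V.monotone (leOfHom f)))

/-- For submodules the transition maps are injective, so only the generation of the supremum by the
chain has to be assumed. -/
theorem closed_iUnion_of_hlim {κ : Cardinal.{u}}
    (hlim : ClosedUnderKContinuousLimits (Order.succ κ) 𝒜) {P : Type u} [AddCommGroup P]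
    [Module A P] {K : Type u} [PartialOrder K] [IsDirectedOrder K] [Nonempty K]
    (V : K →o Submodule A P)
    (hV : ∀ J : Set K, J.Nonempty → IsChain (· ≤ ·) J → Cardinal.mk J ≤ κ →
      ∃ s, IsLUB J s ∧ V s ≤ ⨆ j : J, V j)
    (h𝒜 : ∀ k, 𝒜 (ModuleCat.of A (V k))) {W : Submodule A P} (hW : W = ⨆ k, V k) :
    𝒜 (ModuleCat.of A W) := by
  have hVW : ∀ k, V k ≤ W := fun k => (le_iSup V k).trans hW.ge
  let c : Cocone (submoduleSystem V) :=
    { pt := ModuleCat.of A W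
      ι :=
        { app := fun k => ModuleCat.ofHom (Submodule.inclusion (hVW k))
          naturality := fun _ _ _ => rfl } }
  have hc : Nonempty (IsColimit c) := by
    refine nonempty_isColimit_of_elementwise ?_ ?_
    · rintro ⟨z, hz⟩
      rw [hW, Submodule.mem_iSup_of_directed _ V.monotone.directed_le] at hz
      obtain ⟨k, hk⟩ := hz
      exact ⟨k, ⟨z, hk⟩, rfl⟩
    · intro k x hx
      have hx' : x = 0 := Submodule.inclusion_injective (hVW k) (hx.trans (map_zero _).symm)
      refine ⟨k, le_rfl, ?_⟩
      rw [hx', map_zero]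
  refine hlim K (submoduleSystem V) ?_ h𝒜 c hc.some
  intro J hJ hchain hcard
  obtain ⟨s, hs, hVs⟩ := hV J hJ hchain (Order.lt_succ_iff.1 hcard)
  have : Nonempty J := hJ.to_subtype
  have : IsDirectedOrder J := ⟨fun a b => by
    rcases hchain.total a.2 b.2 with h | h
    · exact ⟨b, h, le_rfl⟩
    · exact ⟨a, le_rfl, h⟩⟩
  refine ⟨s, hs, nonempty_isColimit_of_elementwise ?_ ?_⟩
  · rintro ⟨z, hz⟩
    have hz' := hVs hz
    rw [Submodule.mem_iSup_of_directed _
      (Monotone.directed_le fun (a b : J) h => V.monotone h)] at hz'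
    obtain ⟨k, hk⟩ := hz'
    exact ⟨k, ⟨z, hk⟩, rfl⟩
  · intro k x hx
    have hx' : x = 0 := Submodule.inclusion_injective (V.monotone (hs.1 k.2))
      (hx.trans (map_zero _).symm)
    refine ⟨k, le_rfl, ?_⟩
    rw [hx', map_zero]

/-- Sets of at most `κ` branches are closed under unions of at most `κ` of them, so their spans form
a `κ⁺`-continuous system with union the whole tree module. -/
theorem branchSpan_univ_mem {κ : Cardinal.{u}} (hκ : Cardinal.aleph0 ≤ κ)
    (hlim : ClosedUnderKContinuousLimits (Order.succ κ) 𝒜) (hfilt : ClosedUnderFiltrations 𝒜)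
    (hΛ : Cardinal.mk Λ = κ) [Nonempty H]
    (hspan : ∀ e : Λ → H, IsFilteredOver 𝒜 ⊥ (branchSpan C p (Set.range e))) :
    𝒜 (ModuleCat.of A (branchSpan C p (Set.univ : Set H))) := by
  -- Nonemptiness lets each such set be enumerated by all of `Λ`, with repetitions.
  let K := {X : Set H // X.Nonempty ∧ Cardinal.mk X ≤ κ}
  have hsup : ∀ J : Set K, J.Nonempty → Cardinal.mk J ≤ κ →
      (⋃ X : J, X.1.1).Nonempty ∧ Cardinal.mk (⋃ X : J, X.1.1 : Set H) ≤ κ := by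
    intro J hJ hcard
    obtain ⟨X, hX⟩ := hJ
    refine ⟨X.2.1.mono (Set.subset_iUnion (fun X : J => X.1.1) ⟨X, hX⟩), ?_⟩
    refine (Cardinal.mk_iUnion_le _).trans ?_
    refine (mul_le_mul' hcard (ciSup_le' fun X : J => X.1.2.2)).trans ?_
    exact (Cardinal.mul_eq_self hκ).le
  have hdir : IsDirectedOrder K := ⟨fun X Y => by
    refine ⟨⟨X.1 ∪ Y.1, X.2.1.mono Set.subset_union_left, (Cardinal.mk_union_le _ _).trans ?_⟩,
      Set.subset_union_left, Set.subset_union_right⟩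
    exact (add_le_add X.2.2 Y.2.2).trans (Cardinal.add_eq_self hκ).le⟩
  have hsing : ∀ E : H, ({E} : Set H).Nonempty ∧ Cardinal.mk ({E} : Set H) ≤ κ := fun E =>
    ⟨Set.singleton_nonempty E, by
      rw [Cardinal.mk_singleton]
      exact (Cardinal.one_lt_aleph0.le.trans hκ)⟩
  have hnem : Nonempty K := ⟨⟨{Classical.arbitrary H}, hsing _⟩⟩
  let V : K →o Submodule A (∀ β : Λ, T → C.obj β) :=
    ⟨fun X => branchSpan C p X.1, fun X Y h => branchSpan_mono h⟩
  refine closed_iUnion_of_hlim hlim V ?_ ?_ ?_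
  · intro J hJ _ hcard
    refine ⟨⟨_, hsup J hJ hcard⟩, ⟨?_, ?_⟩, ?_⟩
    · intro X hX
      exact Set.subset_iUnion (fun X : J => X.1.1) ⟨X, hX⟩
    · intro Y hY
      exact Set.iUnion_subset fun X => hY X.2
    · refine branchSpan_le fun E hE α x => ?_
      obtain ⟨X, hX⟩ := Set.mem_iUnion.1 hE
      exact (le_iSup (fun X : J => V X) X) (branchMap_mem_branchSpan hX x)
  · rintro ⟨X, hX, hcard⟩
    refine hfilt.of_submodule ?_
    have : Nonempty X := hX.to_subtype
    have h1 : Cardinal.mk X ≤ Cardinal.mk Λ := hcard.trans hΛ.ge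
    obtain ⟨f⟩ := (Cardinal.le_def _ _).1 h1
    have hrange : X = Set.range (fun i : Λ => (Function.invFun f i).1) := by
      ext E
      constructor
      · intro hE
        exact ⟨f ⟨E, hE⟩, congrArg Subtype.val (Function.leftInverse_invFun f.injective ⟨E, hE⟩)⟩
      · rintro ⟨i, rfl⟩
        exact (Function.invFun f i).2
    have := hspan (fun i : Λ => (Function.invFun f i).1)
    rw [← hrange] at this
    exact this
  · apply le_antisymm
    · refine branchSpan_le fun E _ α x => ?_
      exact Submodule.mem_iSup_of_mem (p := fun X : K => V X) ⟨{E}, hsing E⟩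
        (branchMap_mem_branchSpan (Set.mem_singleton E) x)
    · exact iSup_le fun X => branchSpan_mono (Set.subset_univ _)

end TreeModule

/-! ### Cardinal estimates and the tree. -/

section Cardinality

theorem mk_span_le {A : Type u} [Ring A] {P : Type u} [AddCommGroup P] [Module A P] (s : Set P)
    {μ : Cardinal.{u}} (hμ : Cardinal.aleph0 ≤ μ) (hA : Cardinal.mk A ≤ μ)
    (hs : Cardinal.mk s ≤ μ) : Cardinal.mk (Submodule.span A s) ≤ μ := by
  have h1 : Cardinal.mk (Submodule.span A s) ≤ Cardinal.mk (s →₀ A) := by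
    refine Cardinal.mk_le_of_surjective (f := fun l : s →₀ A =>
      (⟨Finsupp.linearCombination A (Subtype.val : s → P) l,
        (Finsupp.mem_span_iff_linearCombination A s _).2 ⟨l, rfl⟩⟩ : Submodule.span A s)) ?_
    rintro ⟨x, hx⟩
    obtain ⟨l, hl⟩ := (Finsupp.mem_span_iff_linearCombination A s x).1 hx
    exact ⟨l, Subtype.ext hl⟩
  refine h1.trans ?_
  have h2 : Cardinal.mk (s →₀ A) ≤ Cardinal.mk (List (s × A)) := by
    classical
    refine Cardinal.mk_le_of_surjective
      (f := fun l : List (s × A) => (l.map fun x => Finsupp.single x.1 x.2).sum) ?_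
    intro f
    induction f using Finsupp.induction with
    | zero => exact ⟨[], rfl⟩
    | single_add a b f _ _ ih =>
      obtain ⟨l, hl⟩ := ih
      refine ⟨(a, b) :: l, ?_⟩
      simp only [List.map_cons, List.sum_cons]
      rw [← hl]
  refine h2.trans ((Cardinal.mk_list_le_max _).trans (max_le hμ ?_))
  rw [Cardinal.mk_prod, Cardinal.lift_id, Cardinal.lift_id]
  exact (mul_le_mul' hs hA).trans (Cardinal.mul_eq_self hμ).le

theorem mk_Iio_ordToType_lt {c : Cardinal.{u}} (i : c.ord.ToType) :
    Cardinal.mk (Set.Iio i) < c := by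
  simpa using Cardinal.mk_Iio_lt i (by simp)

theorem exists_bound_of_isRegular {κ : Cardinal.{u}} (hκ : κ.IsRegular) {X : Type u}
    (hX : Cardinal.mk X < κ) (f : X → κ.ord.ToType) : ∃ β, ∀ x, f x < β := by
  have h : Cardinal.mk (Set.range f) < Order.cof κ.ord.ToType := by
    rw [Ordinal.cof_toType, hκ.cof_ord]
    exact Cardinal.mk_range_le.trans_lt hX
  have h' : ¬ IsCofinal (Set.range f) := fun h' => (Order.cof_le h').not_gt h
  rw [IsCofinal] at h'
  push Not at h'
  obtain ⟨β, hβ⟩ := h'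
  exact ⟨β, fun x => hβ _ ⟨x, rfl⟩⟩

/-- A tree of height `κ` with few nodes and many branches. -/
theorem exists_tree {κ : Cardinal.{u}} (hκ : κ.IsRegular) (θ : Cardinal.{u}) :
    ∃ (μ : Cardinal.{u}) (H T : Type u) (p : κ.ord.ToType → H → T),
      θ ≤ μ ∧ κ ≤ μ ∧ Cardinal.mk T ≤ μ ∧ Cardinal.mk H = 2 ^ μ ∧
      (∀ {α β : κ.ord.ToType} {E E' : H}, α ≤ β → p β E = p β E' → p α E = p α E') ∧
      (∀ {E E' : H}, E ≠ E' → ∃ β, p β E ≠ p β E') := by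
  -- Branches are subsets of `μ`, and the node at level `β` is the trace on `S β`. The sets `S β`
  -- increase to `μ` and have at most `beth (o + β)` elements, so each level has at most `beth (o +
  -- β + 1) ≤ μ` nodes.
  let o : Ordinal.{u} := (max θ κ).ord
  let μ := Cardinal.beth (o + κ.ord)
  have hlim : Order.IsSuccLimit κ.ord := Cardinal.isSuccLimit_ord hκ.aleph0_le
  have hμ : max θ κ ≤ μ := (Cardinal.le_beth_ord _).trans (Cardinal.beth_mono le_self_add)
  have hμ0 : Cardinal.aleph0 ≤ μ := Cardinal.aleph0_le_beth _
  let lv : κ.ord.ToType → Cardinal.{u} := fun β => Cardinal.beth (o + β.toOrd)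
  have hlvmono : Monotone lv := fun α β h => Cardinal.beth_mono
    (add_le_add le_rfl (show (α.toOrd : Ordinal) ≤ β.toOrd from Ordinal.ToType.mk.symm.monotone h))
  have hlv2 : ∀ β, 2 ^ lv β ≤ μ := by
    intro β
    rw [← Cardinal.beth_succ]
    refine Cardinal.beth_mono (Order.succ_le_of_lt ?_)
    exact (add_lt_add_iff_left o).2 β.toOrd.2
  let S : κ.ord.ToType → Set μ.ord.ToType := fun β => {s | (s.toOrd : Ordinal) < (lv β).ord}
  have hSmono : Monotone S := by
    intro α β h s hs
    have hs' : (s.toOrd : Ordinal) < (lv α).ord := hs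
    exact hs'.trans_le (Cardinal.ord_le_ord.2 (hlvmono h))
  have hScard : ∀ β, Cardinal.mk (S β) ≤ lv β := by
    intro β
    have hinj : Function.Injective (fun s : S β =>
        (Ordinal.ToType.mk ⟨(s.1.toOrd : Ordinal), s.2⟩ : (lv β).ord.ToType)) := by
      intro s t h
      have h' : (s.1.toOrd : Ordinal) = t.1.toOrd :=
        Subtype.mk.inj (Ordinal.ToType.mk.injective h)
      exact Subtype.ext (Ordinal.ToType.mk.symm.injective (Subtype.ext h'))
    exact (Cardinal.mk_le_of_injective hinj).trans (Cardinal.mk_ord_toType _).le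
  have hScover : ∀ s, ∃ β, s ∈ S β := by
    intro s
    have hs : (s.toOrd : Ordinal) < μ.ord := s.toOrd.2
    have hs' : (s.toOrd : Ordinal).card < μ := Cardinal.lt_ord.1 hs
    have hl : Order.IsSuccLimit (o + κ.ord) := Ordinal.isSuccLimit_add o hlim
    have : Nonempty (Set.Iio (o + κ.ord)) := ⟨⟨0, hl.bot_lt⟩⟩
    obtain ⟨⟨a, ha⟩, hs'⟩ := (lt_ciSup_iff Cardinal.bddAbove_of_small).1
      (hs'.trans_eq (Cardinal.beth_limit hl))
    obtain ⟨β, hβ, haβ⟩ := (Ordinal.lt_add_iff hlim.ne_bot).1 ha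
    refine ⟨Ordinal.ToType.mk ⟨β, hβ⟩, ?_⟩
    change (s.toOrd : Ordinal) < (lv (Ordinal.ToType.mk ⟨β, hβ⟩)).ord
    rw [Cardinal.lt_ord]
    refine hs'.trans_le (Cardinal.beth_mono ?_)
    simpa [Ordinal.ToType.toOrd] using haβ
  let T := {t : Set μ.ord.ToType // ∃ β, t ⊆ S β}
  have hT : Cardinal.mk T ≤ μ := by
    let f : (Σ β : κ.ord.ToType, Set (S β)) → T :=
      fun x => ⟨Subtype.val '' x.2, x.1, by rintro _ ⟨y, -, rfl⟩; exact y.2⟩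
    have hf : Function.Surjective f := by
      rintro ⟨t, β, ht⟩
      refine ⟨⟨β, Subtype.val ⁻¹' t⟩, Subtype.ext ?_⟩
      simp only [f, Subtype.image_preimage_coe]
      exact Set.inter_eq_right.2 ht
    refine (Cardinal.mk_le_of_surjective hf).trans ?_
    rw [Cardinal.mk_sigma]
    refine (Cardinal.sum_le_mk_mul_iSup _).trans ?_
    rw [Cardinal.mk_ord_toType]
    have : (⨆ β, Cardinal.mk (Set (S β))) ≤ μ := by
      refine ciSup_le' fun β => ?_
      rw [Cardinal.mk_set]
      exact (Cardinal.power_le_power_left two_ne_zero (hScard β)).trans (hlv2 β)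
    exact (mul_le_mul' ((le_max_right _ _).trans hμ) this).trans (Cardinal.mul_eq_self hμ0).le
  refine ⟨μ, Set μ.ord.ToType, T, fun β E => ⟨E ∩ S β, β, Set.inter_subset_right⟩,
    (le_max_left _ _).trans hμ, (le_max_right _ _).trans hμ, hT, ?_, ?_, ?_⟩
  · rw [Cardinal.mk_set, Cardinal.mk_ord_toType]
  · intro α β E E' h hEE'
    have h' : E ∩ S β = E' ∩ S β := congrArg Subtype.val hEE'
    refine Subtype.ext ?_
    change E ∩ S α = E' ∩ S α
    rw [← Set.inter_eq_right.2 (hSmono h), ← Set.inter_assoc, h', Set.inter_assoc]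
  · intro E E' hne
    by_contra hcon
    push Not at hcon
    refine hne (Set.ext fun s => ?_)
    obtain ⟨β, hβ⟩ := hScover s
    have h' : E ∩ S β = E' ∩ S β := congrArg Subtype.val (hcon β)
    have := Set.ext_iff.1 h' s
    simpa [hβ] using this

end Cardinality

/-! ### The tree module modulo bounded segments. -/

section TreeQuotient

variable {A : Type u} [Ring A] {Λ : Type u} [LinearOrder Λ]
  {C : Λ ⥤ ModuleCat.{u} A} {H T : Type u} {p : Λ → H → T}

variable (C p) in
/-- The submodule generated by the bounded parts of the branches. -/
noncomputable def segmentSpan : Submodule A (∀ β : Λ, T → C.obj β) :=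
  Submodule.span A {d | ∃ (E : H) (α β : Λ) (h : α ≤ β) (x : C.obj α),
    d = branchMap C p E α x - branchMap C p E β ((C.map (homOfLE h)).hom x)}

/-- A segment is determined by its upper level, the node there, and its starting element. Hence
nodes are counted and not branches. -/
theorem mk_segmentSpan_le {μ : Cardinal.{u}} (hμ : Cardinal.aleph0 ≤ μ) (hA : Cardinal.mk A ≤ μ)
    (hT : Cardinal.mk T ≤ μ) (hΛ : Cardinal.mk Λ ≤ μ) (hC : ∀ α, Cardinal.mk (C.obj α) ≤ μ)
    (hp : ∀ {α β : Λ} {E E' : H}, α ≤ β → p β E = p β E' → p α E = p α E') :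
    Cardinal.mk (segmentSpan C p) ≤ μ := by
  classical
  refine mk_span_le _ hμ hA ?_
  -- Any branch through the given node serves; the value zero covers data of no segment.
  let f : (Λ × T × (Σ α : Λ, C.obj α)) → (∀ β : Λ, T → C.obj β) := fun y =>
    if h : y.2.2.1 ≤ y.1 ∧ ∃ E, p y.1 E = y.2.1 then
      branchMap C p h.2.choose y.2.2.1 y.2.2.2 -
        branchMap C p h.2.choose y.1 ((C.map (homOfLE h.1)).hom y.2.2.2)
    else 0
  have hsub : {d | ∃ (E : H) (α β : Λ) (h : α ≤ β) (x : C.obj α),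
    d = branchMap C p E α x - branchMap C p E β ((C.map (homOfLE h)).hom x)} ⊆ Set.range f := by
    rintro _ ⟨E, α, β, h, x, rfl⟩
    refine ⟨⟨β, p β E, α, x⟩, ?_⟩
    have hE : ∃ E', p β E' = p β E := ⟨E, rfl⟩
    simp only [f]
    rw [dif_pos ⟨h, hE⟩]
    exact branchMap_segment_eq h x fun β' hβ' => hp hβ'.le hE.choose_spec
  refine (Cardinal.mk_le_mk_of_subset hsub).trans (Cardinal.mk_range_le.trans ?_)
  rw [Cardinal.mk_prod, Cardinal.mk_prod, Cardinal.mk_sigma]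
  simp only [Cardinal.lift_id]
  have h1 : Cardinal.sum (fun α : Λ => Cardinal.mk (C.obj α)) ≤ μ :=
    (Cardinal.sum_le_mk_mul_iSup _).trans
      ((mul_le_mul' hΛ (ciSup_le' hC)).trans (Cardinal.mul_eq_self hμ).le)
  refine (mul_le_mul' hΛ ((mul_le_mul' hT h1).trans (Cardinal.mul_eq_self hμ).le)).trans ?_
  exact (Cardinal.mul_eq_self hμ).le

theorem exists_bound_of_mem_segmentSpan [Nonempty Λ] {d : ∀ β : Λ, T → C.obj β}
    (hd : d ∈ segmentSpan C p) : ∃ β₀, ∀ β, β₀ ≤ β → ∀ t, d β t = 0 := by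
  induction hd using Submodule.span_induction with
  | mem d hd =>
    obtain ⟨E, α, β, h, x, rfl⟩ := hd
    refine ⟨β, fun β' hβ' t => ?_⟩
    rw [Pi.sub_apply, Pi.sub_apply]
    by_cases ht : p β' E = t
    · rw [branchMap_apply_of_eq (h.trans hβ') ht, branchMap_apply_of_eq hβ' ht, map_map_apply,
        sub_self]
    · rw [branchMap_apply_of_ne ht, branchMap_apply_of_ne ht, sub_self]
  | zero => exact ⟨Classical.arbitrary Λ, fun _ _ _ => rfl⟩
  | add d d' _ _ h h' =>
    obtain ⟨β₀, h⟩ := h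
    obtain ⟨β₀', h'⟩ := h'
    refine ⟨max β₀ β₀', fun β hβ t => ?_⟩
    rw [Pi.add_apply, Pi.add_apply, h β ((le_max_left _ _).trans hβ),
      h' β ((le_max_right _ _).trans hβ), add_zero]
  | smul r d _ h =>
    obtain ⟨β₀, h⟩ := h
    refine ⟨β₀, fun β hβ t => ?_⟩
    rw [Pi.smul_apply, Pi.smul_apply, h β hβ, smul_zero]

/-- Modulo its bounded part, the tree module is a direct sum of copies of the direct limit, one
for each branch. -/
theorem exists_tree_projection [Nonempty Λ]
    (hp : ∀ {α β : Λ} {E E' : H}, α ≤ β → p β E = p β E' → p α E = p α E')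
    (hsep : ∀ {E E' : H}, E ≠ E' → ∃ β, p β E ≠ p β E') (c : Cocone C) (hc : IsColimit c) :
    ∃ π : branchSpan C p (Set.univ : Set H) →ₗ[A] (H →₀ c.pt), Function.Surjective π ∧
      ∀ z, π z = 0 → z.1 ∈ segmentSpan C p := by
  classical
  set D := segmentSpan C p with hD
  let d : H → Cocone C := fun E =>
    { pt := ModuleCat.of A ((∀ β : Λ, T → C.obj β) ⧸ D)
      ι :=
        { app := fun α => ModuleCat.ofHom (D.mkQ ∘ₗ branchMap C p E α)
          naturality := fun α β f => by
            ext x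
            have : branchMap C p E α x - branchMap C p E β ((C.map f).hom x) ∈ D :=
              Submodule.subset_span ⟨E, α, β, leOfHom f, x, rfl⟩
            rw [← Submodule.Quotient.mk_eq_zero, Submodule.Quotient.mk_sub, sub_eq_zero] at this
            exact this.symm } }
  have hd : ∀ E α (x : C.obj α), (hc.desc (d E)).hom ((c.ι.app α).hom x) =
      D.mkQ (branchMap C p E α x) := fun E α x =>
    LinearMap.congr_fun (congrArg ModuleCat.Hom.hom (hc.fac (d E) α)) x
  let q : (H →₀ c.pt) →ₗ[A] ((∀ β : Λ, T → C.obj β) ⧸ D) :=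
    Finsupp.lsum ℕ fun E => (hc.desc (d E)).hom
  have hq : ∀ E z, q (Finsupp.single E z) = (hc.desc (d E)).hom z := fun E z => by
    simp [q]
  have hqrep : ∀ E α (x : C.obj α), q (Finsupp.single E ((c.ι.app α).hom x)) =
      D.mkQ (branchMap C p E α x) := fun E α x => (hq E _).trans (hd E α x)
  -- A combination of branch elements lying in `D` vanishes at all high levels. High enough, the
  -- branches of the finite support are separated, and the value at the node of `E` isolates the
  -- coordinate at `E`.
  have hinj : Function.Injective q := by
    rw [← LinearMap.ker_eq_bot, LinearMap.ker_eq_bot']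
    intro z hz
    choose α x hx using fun E => exists_rep_of_isColimit hc (z E)
    have hz' : z = ∑ E ∈ z.support, Finsupp.single E ((c.ι.app (α E)).hom (x E)) := by
      simp only [hx]
      exact (Finsupp.sum_single z).symm
    have hmem : ∑ E ∈ z.support, branchMap C p E (α E) (x E) ∈ D := by
      rw [← Submodule.Quotient.mk_eq_zero, ← Submodule.mkQ_apply, map_sum, ← hz, hz', map_sum]
      rw [← hz']
      exact Finset.sum_congr rfl fun E _ => (hqrep E _ _).symm
    obtain ⟨β₀, hβ₀⟩ := exists_bound_of_mem_segmentSpan hmem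
    ext E
    by_cases hE : E ∈ z.support
    swap
    · simpa using hE
    have hs : ∀ E', ∃ β, E ≠ E' → p β E ≠ p β E' := fun E' => by
      by_cases h : E = E'
      · exact ⟨β₀, fun h' => (h' h).elim⟩
      · obtain ⟨β, hβ⟩ := hsep h
        exact ⟨β, fun _ => hβ⟩
    choose s hs using hs
    obtain ⟨β₁, hβ₁⟩ : ∃ β₁, ∀ E' ∈ z.support, s E' ≤ β₁ := by
      obtain ⟨m, hm⟩ := (z.support.image s).exists_le
      exact ⟨m, fun E' hE' => hm _ (Finset.mem_image_of_mem s hE')⟩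
    let β := max (max β₀ β₁) (α E)
    have hβα : α E ≤ β := le_max_right _ _
    have h0 := hβ₀ β ((le_max_left _ _).trans (le_max_left _ _)) (p β E)
    rw [Finset.sum_apply, Finset.sum_apply, Finset.sum_eq_single E] at h0
    · rw [branchMap_apply_of_eq hβα rfl] at h0
      rw [← hx E, ← cocone_w_apply c hβα, h0, map_zero, Finsupp.zero_apply]
    · intro E' hE' hne
      refine branchMap_apply_of_ne (fun h => hs E' hne.symm (hp ?_ h.symm)) _
      exact (hβ₁ E' hE').trans ((le_max_right _ _).trans (le_max_left _ _))
    · exact fun h => (h hE).elim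
  have hrange : ∀ z : branchSpan C p (Set.univ : Set H), D.mkQ z.1 ∈ LinearMap.range q := by
    intro z
    have : branchSpan C p (Set.univ : Set H) ≤ (LinearMap.range q).comap D.mkQ :=
      branchSpan_le fun E _ α x => ⟨_, hqrep E α x⟩
    exact this z.2
  -- `q` identifies the direct sum with a submodule of the quotient by `D` that contains the classes
  -- of all tree elements; `π` is the class map followed by the inverse of `q`.
  let e := LinearEquiv.ofInjective q hinj
  let π : branchSpan C p (Set.univ : Set H) →ₗ[A] (H →₀ c.pt) := e.symm.toLinearMap ∘ₗ
    (D.mkQ ∘ₗ (branchSpan C p (Set.univ : Set H)).subtype).codRestrict (LinearMap.range q) hrange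
  have hπ : ∀ z, q (π z) = D.mkQ z.1 := by
    intro z
    exact congrArg Subtype.val (e.apply_symm_apply ⟨D.mkQ z.1, hrange z⟩)
  refine ⟨π, ?_, ?_⟩
  · rw [← LinearMap.range_eq_top, eq_top_iff]
    intro z _
    induction z using Finsupp.induction_linear with
    | zero => exact Submodule.zero_mem _
    | add f g hf hg => exact Submodule.add_mem _ (hf trivial) (hg trivial)
    | single E z =>
      obtain ⟨α, x, rfl⟩ := exists_rep_of_isColimit hc z
      refine ⟨⟨branchMap C p E α x, branchMap_mem_branchSpan (Set.mem_univ E) x⟩, hinj ?_⟩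
      rw [hπ, hqrep]
  · intro z hz
    have := hπ z
    rw [hz, map_zero] at this
    exact (Submodule.Quotient.mk_eq_zero D).1 this.symm

/-- The tree module of a well-ordered system: a module in `𝒜` which is an extension of many copies
of the direct limit by a small module. -/
theorem exists_tree_module {κ : Cardinal.{u}} (hκ : κ.IsRegular)
    {𝒜 : ObjectProperty (ModuleCat.{u} A)}
    (hlim : ClosedUnderKContinuousLimits (Order.succ κ) 𝒜) (hfilt : ClosedUnderFiltrations 𝒜)
    {C : κ.ord.ToType ⥤ ModuleCat.{u} A} (hC : ∀ α, 𝒜 (C.obj α))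
    (hcont : ∀ γ, (Set.Iio γ).Nonempty → ∃ c : Cocone (subsystem C (Set.Iio γ)),
      Nonempty (IsColimit c) ∧ 𝒜 c.pt)
    (c : Cocone C) (hc : IsColimit c) (θ : Cardinal.{u}) :
    ∃ (μ : Cardinal.{u}) (H : Type u) (L : ModuleCat.{u} A) (π : L →ₗ[A] (H →₀ c.pt)),
      θ ≤ μ ∧ Cardinal.mk H = 2 ^ μ ∧ Cardinal.mk (LinearMap.ker π) ≤ μ ∧
      Function.Surjective π ∧ 𝒜 L := by
  -- `μ` must also dominate the ring and all the `C α` for the span of segments to have size at most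
  -- `μ`.
  let θ' := max (max θ Cardinal.aleph0) (max (Cardinal.mk A) (⨆ α, Cardinal.mk (C.obj α)))
  obtain ⟨μ, H, T, p, hθ, hκμ, hT, hH, hp, hsep⟩ := exists_tree hκ θ'
  have h1 : θ ≤ μ := ((le_max_left _ _).trans (le_max_left _ _)).trans hθ
  have h2 : Cardinal.aleph0 ≤ μ := ((le_max_right _ _).trans (le_max_left _ _)).trans hθ
  have h3 : Cardinal.mk A ≤ μ := ((le_max_left _ _).trans (le_max_right _ _)).trans hθ
  have h4 : ∀ α, Cardinal.mk (C.obj α) ≤ μ := fun α =>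
    (le_ciSup Cardinal.bddAbove_of_small α).trans
      (((le_max_right _ _).trans (le_max_right _ _)).trans hθ)
  have hΛ : Cardinal.mk κ.ord.ToType = κ := Cardinal.mk_ord_toType κ
  have hΛne : Nonempty κ.ord.ToType := by
    rw [← Cardinal.mk_ne_zero_iff, hΛ]
    exact hκ.pos.ne'
  have hHne : Nonempty H := by
    rw [← Cardinal.mk_ne_zero_iff, hH]
    exact (Cardinal.power_pos μ two_pos).ne'
  obtain ⟨π, hsurj, hker⟩ := exists_tree_projection (C := C) (p := p) hp hsep c hc
  refine ⟨μ, H, ModuleCat.of A (branchSpan C p (Set.univ : Set H)), π, h1, hH, ?_, hsurj, ?_⟩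
  · refine le_trans ?_ (mk_segmentSpan_le (C := C) (p := p) h2 h3 hT (hΛ.le.trans hκμ) h4 hp)
    refine Cardinal.mk_le_of_injective
      (f := fun z : LinearMap.ker π => (⟨z.1.1, hker z.1 z.2⟩ : segmentSpan C p)) ?_
    intro z z' h
    exact Subtype.ext (Subtype.ext (Subtype.mk.inj h))
  · have hbdd : ∀ (i : κ.ord.ToType) (f : Set.Iio i → κ.ord.ToType), ∃ β, ∀ j, f j ≤ β := by
      intro i f
      obtain ⟨β, hβ⟩ := exists_bound_of_isRegular hκ (mk_Iio_ordToType_lt i) f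
      exact ⟨β, fun j => (hβ j).le⟩
    have hspan : ∀ e : κ.ord.ToType → H,
        IsFilteredOver 𝒜 ⊥ (branchSpan C p (Set.range e)) := fun e =>
      isFilteredOver_branchSpan (p := p) hp hsep hbdd hC hcont e
    exact branchSpan_univ_mem hκ.aleph0_le hlim hfilt hΛ hspan

end TreeQuotient

/-! ### The counting argument for orthogonal classes. -/

section OrthogonalCounting

variable {A : Type u} [Ring A]

theorem exists_factor_of_surjective {L M E : Type u} [AddCommGroup L] [Module A L]
    [AddCommGroup M] [Module A M] [AddCommGroup E] [Module A E] (π : L →ₗ[A] M)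
    (hπ : Function.Surjective π) (k : L →ₗ[A] E) (hk : ∀ z, π z = 0 → k z = 0) :
    ∃ k' : M →ₗ[A] E, ∀ z, k' (π z) = k z := by
  refine ⟨(LinearMap.ker π).liftQ k (fun z hz => hk z hz) ∘ₗ
    (π.quotKerEquivOfSurjective hπ).symm.toLinearMap, fun z => ?_⟩
  have : (π.quotKerEquivOfSurjective hπ).symm (π z) = (LinearMap.ker π).mkQ z := by
    rw [LinearEquiv.symm_apply_eq]
    rfl
  rw [LinearMap.comp_apply, LinearEquiv.coe_coe, this]
  exact Submodule.liftQ_apply _ _ _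

/-- If many copies of `M` are a quotient of a module with the lifting property by a small submodule,
then `M` has the lifting property. -/
theorem liftsAlong_of_small_kernel {E C : Type u} [AddCommGroup E] [Module A E] [AddCommGroup C]
    [Module A C] (ψ : E →ₗ[A] C) {μ : Cardinal.{u}} (hμ : Cardinal.aleph0 ≤ μ)
    (hψ : Cardinal.mk (LinearMap.ker ψ) ≤ μ) {H : Type u} (hH : Cardinal.mk H = 2 ^ μ)
    {L M : ModuleCat.{u} A} (hL : LiftsAlong ψ L) (π : L →ₗ[A] (H →₀ M))
    (hπ : Function.Surjective π) (hker : Cardinal.mk (LinearMap.ker π) ≤ μ) : LiftsAlong ψ M := by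
  classical
  intro g
  -- Each of the `2 ^ 2 ^ μ` subsets of `H` gives a map to lift, equal to `g` on the selected copies
  -- and zero on the others.
  let G : Set H → ((H →₀ M) →ₗ[A] C) := fun ε => Finsupp.lsum ℕ fun e => if e ∈ ε then g else 0
  have hG : ∀ ε e m, G ε (Finsupp.single e m) = if e ∈ ε then g m else 0 := by
    intro ε e m
    by_cases he : e ∈ ε <;> simp [G, he]
  choose h hh using fun ε => hL (G ε ∘ₗ π)
  have hh' : ∀ ε z, ψ (h ε z) = G ε (π z) := fun ε z => LinearMap.congr_fun (hh ε) z
  -- On `ker π` the lifts take values in `ker ψ`, so at most `(2 ^ μ) ^ μ = 2 ^ μ` restrictions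
  -- occur.
  let r : Set H → (LinearMap.ker π → LinearMap.ker ψ) := fun ε z => ⟨h ε z.1, by
    rw [LinearMap.mem_ker, hh', z.2, map_zero]⟩
  have hcard : ¬ Function.Injective r := by
    intro hinj
    have h1 := Cardinal.mk_le_of_injective hinj
    rw [Cardinal.mk_set, hH, ← Cardinal.power_def] at h1
    have hψ0 : Cardinal.mk (LinearMap.ker ψ) ≤ 2 ^ μ := hψ.trans (Cardinal.cantor μ).le
    have h2 : Cardinal.mk (LinearMap.ker ψ) ^ Cardinal.mk (LinearMap.ker π) ≤ 2 ^ μ := by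
      refine (Cardinal.power_le_power_right hψ0).trans ?_
      rw [← Cardinal.power_mul]
      refine Cardinal.power_le_power_left two_ne_zero ?_
      exact (mul_le_mul' le_rfl hker).trans (Cardinal.mul_eq_self hμ).le
    exact (Cardinal.cantor (2 ^ μ)).not_ge (h1.trans h2)
  -- Two lifts agreeing on `ker π` differ by a map factoring through the direct sum; on a copy
  -- selected by only one of the subsets this map lifts `g`.
  have main : ∀ ε ε' : Set H, r ε = r ε' → ∀ e ∈ ε, e ∉ ε' → ∃ s : M →ₗ[A] E, ψ ∘ₗ s = g := by
    intro ε ε' hr e he he'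
    obtain ⟨k, hk⟩ := exists_factor_of_surjective π hπ (h ε - h ε') (fun z hz => by
      have := Subtype.mk.inj (congrFun hr ⟨z, hz⟩)
      rw [LinearMap.sub_apply, this, sub_self])
    refine ⟨k ∘ₗ Finsupp.lsingle e, LinearMap.ext fun m => ?_⟩
    obtain ⟨z, hz⟩ := hπ (Finsupp.single e m)
    rw [LinearMap.comp_apply, LinearMap.comp_apply, Finsupp.lsingle_apply, ← hz, hk,
      LinearMap.sub_apply, map_sub, hh', hh', hz, hG, hG, if_pos he, if_neg he', sub_zero]
  rw [Function.Injective] at hcard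
  push Not at hcard
  obtain ⟨ε, ε', hr, hne⟩ := hcard
  obtain ⟨e, he⟩ : ∃ e, ¬ (e ∈ ε ↔ e ∈ ε') := by
    by_contra hcon
    push Not at hcon
    exact hne (Set.ext hcon)
  by_cases h1 : e ∈ ε
  · exact main ε ε' hr e h1 fun h2 => he ⟨fun _ => h2, fun _ => h1⟩
  · exact main ε' ε hr.symm e (by tauto) h1

end OrthogonalCounting

/-! ### Closed sets of indices, after Hill's lemma. -/

section Hill

variable {A : Type u} [Ring A] {S : ObjectProperty (ModuleCat.{u} A)}
  {L : Type u} [AddCommGroup L] [Module A L] {ι : Type u} [LinearOrder ι]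

/-- By the modular law `(N + W)/(N + V)` is `W/(V + W ∩ N)`, which is `W/V` here. -/
theorem IsStep.sup {V W N : Submodule A L} (h : IsStep S V W) (hN : W ⊓ N ≤ V) :
    IsStep S (N ⊔ V) (N ⊔ W) := by
  obtain rfl | ⟨hle, X, hX, φ, h₁, h₂⟩ := h
  · exact Or.inl rfl
  have hf : (Submodule.factor (le_sup_right : V ≤ N ⊔ V)) ∘ₗ V.mkQ = (N ⊔ V).mkQ := rfl
  refine Or.inr ⟨sup_le_sup_left hle _, X, hX,
    (Submodule.factor (le_sup_right : V ≤ N ⊔ V)) ∘ₗ φ, ?_, ?_⟩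
  · rw [← LinearMap.ker_eq_bot, LinearMap.ker_eq_bot']
    intro x hx
    have hx' : φ x ∈ W.map V.mkQ := by rw [← h₂]; exact ⟨x, rfl⟩
    obtain ⟨w, hw, hwx⟩ := hx'
    rw [LinearMap.comp_apply, ← hwx, ← LinearMap.comp_apply, hf, Submodule.mkQ_apply,
      Submodule.Quotient.mk_eq_zero] at hx
    obtain ⟨n, hn, v, hv, rfl⟩ := Submodule.mem_sup.1 hx
    have hnW : n ∈ W := by
      have := Submodule.sub_mem _ hw (hle hv)
      rwa [add_sub_cancel_right] at this
    have : V.mkQ (n + v) = 0 :=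
      (Submodule.Quotient.mk_eq_zero V).2 (Submodule.add_mem _ (hN ⟨hnW, hn⟩) hv)
    rw [this] at hwx
    exact h₁ (hwx.symm.trans (map_zero φ).symm)
  · rw [LinearMap.range_comp, h₂, ← Submodule.map_comp, hf, Submodule.map_sup]
    have : N.map (N ⊔ V).mkQ = ⊥ := by
      rw [eq_bot_iff, Submodule.map_le_iff_le_comap, Submodule.comap_bot, Submodule.ker_mkQ]
      exact le_sup_left
    rw [this, bot_sup_eq]

/-- Each factor has at most `μ` elements; lifting them gives a small submodule that generates the
next stage over the previous one, so the stages do not change. -/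
theorem exists_small_generators [WellFoundedLT ι] {μ : Cardinal.{u}} (hμ : Cardinal.aleph0 ≤ μ)
    (hA : Cardinal.mk A ≤ μ) (hS : ∀ X, S X → Cardinal.mk X ≤ μ) (G : ι → Submodule A L)
    (hG : ∀ i, IsStep S (stageLT ⊥ G i) (stageLE ⊥ G i)) :
    ∃ a : ι → Submodule A L, (∀ i, Cardinal.mk (a i) ≤ μ) ∧ (⨆ i, a i) = (⨆ i, G i) ∧
      ∀ i, IsStep S (stageLT ⊥ a i) (stageLE ⊥ a i) := by
  have hex : ∀ i, ∃ a : Submodule A L, Cardinal.mk a ≤ μ ∧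
      stageLT ⊥ G i ⊔ a = stageLE ⊥ G i := by
    intro i
    obtain h | ⟨hle, X, hX, φ, h₁, h₂⟩ := hG i
    · refine ⟨⊥, ?_, by rw [sup_bot_eq, h]⟩
      rw [Cardinal.mk_eq_one]
      exact Cardinal.one_lt_aleph0.le.trans hμ
    · choose f hf using fun x => Submodule.mkQ_surjective (stageLT ⊥ G i) (φ x)
      refine ⟨Submodule.span A (Set.range f), mk_span_le _ hμ hA
        (Cardinal.mk_range_le.trans (hS X hX)), ?_⟩
      have : (stageLT ⊥ G i ⊔ Submodule.span A (Set.range f)).map (stageLT ⊥ G i).mkQ =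
          (stageLE ⊥ G i).map (stageLT ⊥ G i).mkQ := by
        rw [← h₂]
        apply le_antisymm
        · rw [Submodule.map_sup, Submodule.mkQ_map_self, bot_sup_eq, Submodule.map_span_le]
          rintro _ ⟨x, rfl⟩
          exact ⟨x, (hf x).symm⟩
        · rintro _ ⟨x, rfl⟩
          exact ⟨f x, Submodule.mem_sup_right (Submodule.subset_span ⟨x, rfl⟩), hf x⟩
      have h3 := congrArg (Submodule.comap (stageLT ⊥ G i).mkQ) this
      rw [Submodule.comap_map_mkQ, Submodule.comap_map_mkQ, sup_eq_right.2 hle,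
        sup_eq_right.2 le_sup_left] at h3
      exact h3
  choose a ha₁ ha₂ using hex
  have hlt : ∀ i, (∀ j < i, stageLE ⊥ a j = stageLE ⊥ G j) → stageLT ⊥ a i = stageLT ⊥ G i := by
    intro i hi
    apply le_antisymm
    · refine (stageLT_le_iff _ _).2 ⟨bot_le, fun j hj => (self_le_stageLE ⊥ a le_rfl).trans ?_⟩
      rw [hi j hj]
      exact stageLE_le_stageLT _ _ hj
    · refine (stageLT_le_iff _ _).2 ⟨bot_le, fun j hj => (self_le_stageLE ⊥ G le_rfl).trans ?_⟩
      rw [← hi j hj]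
      exact stageLE_le_stageLT _ _ hj
  have hle : ∀ i, stageLE ⊥ a i = stageLE ⊥ G i := by
    intro i
    induction i using WellFoundedLT.induction with
    | ind i ih => rw [stageLE_eq, hlt i ih, ha₂]
  refine ⟨a, ha₁, ?_, fun i => ?_⟩
  · apply le_antisymm
    · refine iSup_le fun i => (self_le_stageLE ⊥ a le_rfl).trans ?_
      rw [hle]
      exact (stageLE_le_iff _ _).2 ⟨bot_le, fun j _ => le_iSup G j⟩
    · refine iSup_le fun i => (self_le_stageLE ⊥ G le_rfl).trans ?_
      rw [← hle]
      exact (stageLE_le_iff _ _).2 ⟨bot_le, fun j _ => le_iSup a j⟩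
  · rw [hlt i fun j _ => hle j, hle]
    exact hG i

variable (a : ι → Submodule A L)

open Classical in
/-- The subfamily of `a` indexed by `c`, extended by zero. -/
noncomputable def restrictFamily (c : Set ι) (i : ι) : Submodule A L :=
  if i ∈ c then a i else ⊥

/-- A set of indices is closed if the relations between the selected generators and the previous
ones already hold within the selected ones. -/
def IsHillClosed (c : Set ι) : Prop :=
  ∀ i ∈ c, a i ⊓ stageLT ⊥ a i ≤ stageLT ⊥ (restrictFamily a c) i

variable {a}

theorem restrictFamily_of_mem {c : Set ι} {i : ι} (h : i ∈ c) : restrictFamily a c i = a i := by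
  simp [restrictFamily, h]

theorem restrictFamily_of_notMem {c : Set ι} {i : ι} (h : i ∉ c) : restrictFamily a c i = ⊥ := by
  simp [restrictFamily, h]

theorem restrictFamily_le (c : Set ι) (i : ι) : restrictFamily a c i ≤ a i := by
  by_cases h : i ∈ c
  · exact (restrictFamily_of_mem h).le
  · rw [restrictFamily_of_notMem h]; exact bot_le

theorem restrictFamily_mono {c c' : Set ι} (h : c ⊆ c') (i : ι) :
    restrictFamily a c i ≤ restrictFamily a c' i := by
  by_cases hi : i ∈ c
  · rw [restrictFamily_of_mem hi, restrictFamily_of_mem (h hi)]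
  · rw [restrictFamily_of_notMem hi]; exact bot_le

theorem stageLT_mono_family {G G' : ι → Submodule A L} (h : ∀ i, G i ≤ G' i) (i : ι) :
    stageLT ⊥ G i ≤ stageLT ⊥ G' i :=
  (stageLT_le_iff _ _).2 ⟨bot_le, fun _ hj => (h _).trans (self_le_stageLT _ _ hj)⟩

theorem IsHillClosed.iUnion {κ : Sort*} {c : κ → Set ι} (h : ∀ k, IsHillClosed a (c k)) :
    IsHillClosed a (⋃ k, c k) := by
  intro i hi
  obtain ⟨k, hk⟩ := Set.mem_iUnion.1 hi
  exact (h k i hk).trans (stageLT_mono_family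
    (restrictFamily_mono (Set.subset_iUnion c k)) i)

/-- The submodule generated by the members of `a` with index in `c`. -/
def hillSpan (a : ι → Submodule A L) (c : Set ι) : Submodule A L := ⨆ i : c, a i

theorem le_hillSpan {c : Set ι} {i : ι} (h : i ∈ c) : a i ≤ hillSpan a c :=
  le_iSup (fun i : c => a i) ⟨i, h⟩

theorem hillSpan_mono {c c' : Set ι} (h : c ⊆ c') : hillSpan a c ≤ hillSpan a c' :=
  iSup_le fun i => le_hillSpan (h i.2)

theorem mk_hillSpan_le {μ : Cardinal.{u}} (hμ : Cardinal.aleph0 ≤ μ) (hA : Cardinal.mk A ≤ μ)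
    (ha : ∀ i, Cardinal.mk (a i) ≤ μ) {c : Set ι} (hc : Cardinal.mk c ≤ μ) :
    Cardinal.mk (hillSpan a c) ≤ μ := by
  rw [hillSpan, Submodule.iSup_eq_span]
  refine mk_span_le _ hμ hA ((Cardinal.mk_iUnion_le _).trans ?_)
  exact (mul_le_mul' hc (ciSup_le' fun i : c => ha i.1)).trans (Cardinal.mul_eq_self hμ).le

theorem exists_mem_stageLE_of_mem_hillSpan {c : Set ι} {x : L} (hx : x ∈ hillSpan a c) :
    x = 0 ∨ ∃ k, x ∈ stageLE ⊥ (restrictFamily a c) k := by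
  rcases isEmpty_or_nonempty c with h | h
  · left
    rw [hillSpan, iSup_of_empty] at hx
    exact (Submodule.mem_bot A).1 hx
  · right
    have hle : hillSpan a c ≤ ⨆ k : c, stageLE ⊥ (restrictFamily a c) k := by
      refine iSup_le fun i => ?_
      intro y hy
      have h1 : y ∈ restrictFamily a c i.1 := by rwa [restrictFamily_of_mem i.2]
      exact Submodule.mem_iSup_of_mem (p := fun k : c => stageLE ⊥ (restrictFamily a c) k.1) i
        (self_le_stageLE ⊥ (restrictFamily a c) le_rfl h1)
    have hdir : Directed (· ≤ ·) fun k : c => stageLE ⊥ (restrictFamily a c) k.1 :=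
      Monotone.directed_le fun k l h => stageLE_mono ⊥ (restrictFamily a c) h
    have hx' := (Submodule.mem_iSup_of_directed _ hdir).1 (hle hx)
    obtain ⟨k, hk⟩ := hx'
    exact ⟨k.1, hk⟩

/-- Descend on the stage `k` of the subfamily containing `x`. While `k > i`, the component of `x` in
`a k` lies below `k`, and closedness rewrites it by smaller selected indices. Once `k ≤ i`, the
claim holds because `i` is not selected. -/
theorem IsHillClosed.inf_le [WellFoundedLT ι] {c : Set ι} (hc : IsHillClosed a c) {i : ι}
    (hi : i ∉ c) : stageLE ⊥ a i ⊓ hillSpan a c ≤ stageLT ⊥ a i := by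
  rintro x ⟨hxi, hx⟩
  rcases exists_mem_stageLE_of_mem_hillSpan hx with rfl | ⟨k, hk⟩
  · exact Submodule.zero_mem _
  clear hx
  induction k using WellFoundedLT.induction with
  | ind k ih =>
    rcases le_or_gt k i with hki | hki
    · refine (?_ : stageLE ⊥ (restrictFamily a c) k ≤ stageLT ⊥ a i) hk
      refine (stageLE_le_iff _ _).2 ⟨bot_le, fun j hj => ?_⟩
      rcases (hj.trans hki).lt_or_eq with h | rfl
      · exact (restrictFamily_le c j).trans (self_le_stageLT _ _ h)
      · rw [restrictFamily_of_notMem hi]; exact bot_le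
    · have hlt : x ∈ stageLT ⊥ (restrictFamily a c) k := by
        rw [stageLE_eq] at hk
        by_cases hkc : k ∈ c
        · rw [restrictFamily_of_mem hkc] at hk
          obtain ⟨y, hy, z, hz, rfl⟩ := Submodule.mem_sup.1 hk
          refine Submodule.add_mem _ hy (hc k hkc ⟨hz, ?_⟩)
          have h1 : y + z ∈ stageLT ⊥ a k := stageLE_le_stageLT _ _ hki hxi
          have h2 : y ∈ stageLT ⊥ a k := stageLT_mono_family (restrictFamily_le c) k hy
          have := Submodule.sub_mem _ h1 h2
          rwa [add_sub_cancel_left] at this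
        · rwa [restrictFamily_of_notMem hkc, sup_bot_eq] at hk
      rcases (mem_stageLT_iff _ _).1 hlt with h0 | ⟨j, hj, hxj⟩
      · rw [(Submodule.mem_bot A).1 h0]; exact Submodule.zero_mem _
      · exact ih j hj hxj

/-- Over the span of `c`, selected indices give trivial steps and the others keep their old factors.
-/
theorem IsHillClosed.isFilteredOver [WellFoundedLT ι] {c : Set ι} (hc : IsHillClosed a c)
    (ha : ∀ i, IsStep S (stageLT ⊥ a i) (stageLE ⊥ a i)) (htop : ⨆ i, a i = ⊤) :
    IsFilteredOver S (hillSpan a c) ⊤ := by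
  refine ⟨ι, inferInstance, inferInstance, a, by rw [htop, sup_top_eq], fun i => ?_⟩
  by_cases hi : i ∈ c
  · left
    rw [stageLE_eq, sup_eq_left.2 ((le_hillSpan hi).trans (le_stageLT _ _ _))]
  · have := (ha i).sup (hc.inf_le hi)
    simpa only [stageLT, stageLE, bot_sup_eq] using this

/-- Every element of `Y` involves finitely many indices of `I`; the union of small closed sets
around these is closed and small. -/
theorem exists_closed_of_forall_mem {μ : Cardinal.{u}} (hμ : Cardinal.aleph0 ≤ μ) {I : Set ι}
    (hI : ∀ j ∈ I, ∃ c : Set ι, IsHillClosed a c ∧ j ∈ c ∧ c ⊆ Set.Iic j ∧ Cardinal.mk c ≤ μ)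
    {Y : Set L} (hY : Cardinal.mk Y ≤ μ) (hYI : Y ⊆ hillSpan a I) :
    ∃ c : Set ι, IsHillClosed a c ∧ Y ⊆ hillSpan a c ∧ (∀ k ∈ c, ∃ j ∈ I, k ≤ j) ∧
      Cardinal.mk c ≤ μ := by
  choose! d hd₁ hd₂ hd₃ hd₄ using hI
  choose F hF using fun y : Y => Submodule.mem_iSup_iff_exists_finset.1 (hYI y.2)
  refine ⟨⋃ y : Y, ⋃ j : F y, d j.1.1, ?_, ?_, ?_, ?_⟩
  · exact IsHillClosed.iUnion fun y => IsHillClosed.iUnion fun j => hd₁ _ j.1.2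
  · intro y hy
    refine (iSup₂_le fun j hj => ?_ : (⨆ j ∈ F ⟨y, hy⟩, a j.1) ≤ _) (hF ⟨y, hy⟩)
    exact le_hillSpan (Set.mem_iUnion.2 ⟨⟨y, hy⟩, Set.mem_iUnion.2 ⟨⟨j, hj⟩, hd₂ _ j.2⟩⟩)
  · intro k hk
    obtain ⟨y, hk⟩ := Set.mem_iUnion.1 hk
    obtain ⟨j, hk⟩ := Set.mem_iUnion.1 hk
    exact ⟨j.1.1, j.1.2, hd₃ _ j.1.2 hk⟩
  · refine (Cardinal.mk_iUnion_le _).trans ((mul_le_mul' hY (ciSup_le' fun y => ?_)).trans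
      (Cardinal.mul_eq_self hμ).le)
    refine (Cardinal.mk_iUnion_le _).trans ((mul_le_mul' ?_ (ciSup_le' fun j =>
      hd₄ _ j.1.2)).trans (Cardinal.mul_eq_self hμ).le)
    exact (Cardinal.lt_aleph0_of_finite _).le.trans hμ

/-- The relations `a i ⊓ stageLT ⊥ a i` number at most `μ` and involve indices below `i`, so by
induction a small closed set below `i` accounts for all of them. -/
theorem exists_closed_mem [WellFoundedLT ι] {μ : Cardinal.{u}} (hμ : Cardinal.aleph0 ≤ μ)
    (ha : ∀ i, Cardinal.mk (a i) ≤ μ) (i : ι) :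
    ∃ c : Set ι, IsHillClosed a c ∧ i ∈ c ∧ c ⊆ Set.Iic i ∧ Cardinal.mk c ≤ μ := by
  induction i using WellFoundedLT.induction with
  | ind i ih =>
    obtain ⟨c, hc₁, hc₂, hc₃, hc₄⟩ := exists_closed_of_forall_mem (a := a) (I := Set.Iio i) hμ
      (fun j hj => ih j hj) (Y := (a i ⊓ stageLT ⊥ a i : Submodule A L))
      ((Cardinal.mk_le_mk_of_subset (fun x hx => hx.1)).trans (ha i)) (by
        rintro x ⟨-, hx⟩
        refine (?_ : stageLT ⊥ a i ≤ hillSpan a (Set.Iio i)) hx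
        exact (stageLT_le_iff _ _).2 ⟨bot_le, fun j hj => le_hillSpan hj⟩)
    refine ⟨insert i c, ?_, Set.mem_insert _ _, ?_, ?_⟩
    · rintro k (rfl | hk)
      · intro x hx
        refine (?_ : hillSpan a c ≤ _) (hc₂ hx)
        refine iSup_le fun j => ?_
        obtain ⟨l, hl, hjl⟩ := hc₃ j.1 j.2
        rw [← restrictFamily_of_mem (a := a) (Set.mem_insert_of_mem k j.2)]
        exact self_le_stageLT _ _ (hjl.trans_lt hl)
      · exact (hc₁ k hk).trans (stageLT_mono_family
          (restrictFamily_mono (Set.subset_insert i c)) k)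
    · rintro k (rfl | hk)
      · exact le_rfl
      · obtain ⟨l, hl, hkl⟩ := hc₃ k hk
        exact hkl.trans (le_of_lt hl)
    · refine (Cardinal.mk_insert_le).trans ?_
      exact (add_le_add hc₄ (Cardinal.one_lt_aleph0.le.trans hμ)).trans (Cardinal.add_eq_self hμ).le

theorem exists_closed_of_small [WellFoundedLT ι] {μ : Cardinal.{u}} (hμ : Cardinal.aleph0 ≤ μ)
    (ha : ∀ i, Cardinal.mk (a i) ≤ μ) (htop : ⨆ i, a i = ⊤) {Y : Set L}
    (hY : Cardinal.mk Y ≤ μ) :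
    ∃ c : Set ι, IsHillClosed a c ∧ Y ⊆ hillSpan a c ∧ Cardinal.mk c ≤ μ := by
  obtain ⟨c, hc₁, hc₂, -, hc₃⟩ := exists_closed_of_forall_mem (a := a) (I := Set.univ) hμ
    (fun j _ => exists_closed_mem hμ ha j) hY (by
      intro y _
      have : hillSpan a Set.univ = ⊤ := by
        rw [eq_top_iff, ← htop]
        exact iSup_le fun i => le_hillSpan (Set.mem_univ i)
      rw [this]
      trivial)
  exact ⟨c, hc₁, hc₂, hc₃⟩

end Hill

/-! ### Splitting off a copy of the limit. -/

section DirectSummands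

variable {A : Type u} [Ring A]

theorem exists_prod_equiv_of_section {Q M : Type u} [AddCommGroup Q] [Module A Q]
    [AddCommGroup M] [Module A M] (r : Q →ₗ[A] M) (s : M →ₗ[A] Q) (h : ∀ m, r (s m) = m) :
    Nonempty (Q ≃ₗ[A] (M × LinearMap.ker r)) := by
  let t : Q →ₗ[A] LinearMap.ker r := (LinearMap.id - s ∘ₗ r).codRestrict _ (fun q => by
    simp [LinearMap.mem_ker, h])
  have ht : ∀ q, (t q : Q) = q - s (r q) := fun q => rfl
  refine ⟨LinearEquiv.ofBijective (r.prod t) ⟨?_, ?_⟩⟩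
  · rw [← LinearMap.ker_eq_bot, LinearMap.ker_eq_bot']
    intro q hq
    have h1 : r q = 0 := congrArg Prod.fst hq
    have h2 : (t q : Q) = 0 := congrArg Subtype.val (congrArg Prod.snd hq)
    rwa [ht, h1, map_zero, sub_zero] at h2
  · rintro ⟨m, k, hk⟩
    have hk' : r k = 0 := hk
    refine ⟨s m + k, Prod.ext ?_ (Subtype.ext ?_)⟩
    · simp [h, hk']
    · change (t (s m + k) : Q) = k
      rw [ht, map_add, h, hk', add_zero, add_sub_cancel_left]

/-- The kernel together with one chosen preimage for each element of each copy in `Y` generates the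
preimage. -/
theorem mk_comap_supported_le {L M H : Type u} [AddCommGroup L] [Module A L] [AddCommGroup M]
    [Module A M] (π : L →ₗ[A] (H →₀ M)) (hπ : Function.Surjective π) {μ : Cardinal.{u}}
    (hμ : Cardinal.aleph0 ≤ μ) (hA : Cardinal.mk A ≤ μ) (hM : Cardinal.mk M ≤ μ)
    (hker : Cardinal.mk (LinearMap.ker π) ≤ μ) {Y : Set H} (hY : Cardinal.mk Y ≤ μ) :
    Cardinal.mk ((Finsupp.supported M A Y).comap π) ≤ μ := by
  choose sec hsec using hπ
  let T : Set L := (LinearMap.ker π : Set L) ∪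
    Set.range fun y : Y × M => sec (Finsupp.single y.1.1 y.2)
  have hT : Cardinal.mk T ≤ μ := by
    refine (Cardinal.mk_union_le _ _).trans ((add_le_add hker ?_).trans
      (Cardinal.add_eq_self hμ).le)
    refine Cardinal.mk_range_le.trans ?_
    rw [Cardinal.mk_prod, Cardinal.lift_id, Cardinal.lift_id]
    exact (mul_le_mul' hY hM).trans (Cardinal.mul_eq_self hμ).le
  refine le_trans (Cardinal.mk_le_mk_of_subset ?_) (mk_span_le T hμ hA hT)
  intro z hz
  have hz' : ((π z).support : Set H) ⊆ Y := hz
  let w := ∑ y ∈ (π z).support, sec (Finsupp.single y (π z y))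
  have hw : w ∈ Submodule.span A T := Submodule.sum_mem _ fun y hy =>
    Submodule.subset_span (Or.inr ⟨⟨⟨y, hz' hy⟩, π z y⟩, rfl⟩)
  have hzw : z - w ∈ Submodule.span A T := by
    refine Submodule.subset_span (Or.inl ?_)
    change π (z - w) = 0
    rw [map_sub, map_sum, sub_eq_zero]
    simp only [hsec]
    exact (Finsupp.sum_single (π z)).symm
  have := Submodule.add_mem _ hzw hw
  rwa [sub_add_cancel] at this

/-- If many copies of `M` are a quotient of an `S`-filtered module by a small submodule, then `M`
is a direct summand of an `S`-filtered module. -/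
theorem exists_filtClass_summand {S : ObjectProperty (ModuleCat.{u} A)} {μ : Cardinal.{u}}
    (hμ : Cardinal.aleph0 ≤ μ) (hA : Cardinal.mk A ≤ μ) (hS : ∀ X, S X → Cardinal.mk X ≤ μ)
    {H : Type u} (hH : Cardinal.mk H = 2 ^ μ) {L M : ModuleCat.{u} A} (hM : Cardinal.mk M ≤ μ)
    (hL : FiltClass S L) (π : L →ₗ[A] (H →₀ M)) (hπ : Function.Surjective π)
    (hker : Cardinal.mk (LinearMap.ker π) ≤ μ) :
    ∃ Q K : ModuleCat.{u} A, FiltClass S Q ∧ Nonempty (Q ≃ₗ[A] (M × K)) := by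
  classical
  obtain ⟨ι, _, _, G, hG, hs⟩ := hL.isFilteredOver
  obtain ⟨a, ha, haG, hstep⟩ := exists_small_generators hμ hA hS G hs
  have htop : ⨆ i, a i = ⊤ := by rw [haG, ← hG, bot_sup_eq]
  let Small : Set ι → Prop := fun c => IsHillClosed a c ∧ Cardinal.mk c ≤ μ
  let supp : Set ι → Set H := fun c => ⋃ z : hillSpan a c, ((π z.1).support : Set H)
  have hsupp : ∀ c, Small c → Cardinal.mk (supp c) ≤ μ := by
    intro c hc
    refine (Cardinal.mk_iUnion_le _).trans ((mul_le_mul' (mk_hillSpan_le hμ hA ha hc.2)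
      (ciSup_le' fun z => ?_)).trans (Cardinal.mul_eq_self hμ).le)
    exact (Cardinal.lt_aleph0_of_finite _).le.trans hμ
  -- Closing off alternates between closed index sets in `L` and supports in `H`; after countably
  -- many rounds the span is exactly the preimage of a subsum.
  have hnext : ∀ c : {c // Small c}, ∃ c' : {c // Small c}, c.1 ⊆ c'.1 ∧
      (Finsupp.supported M A (supp c.1)).comap π ≤ hillSpan a c'.1 := by
    rintro ⟨c, hc⟩
    obtain ⟨d, hd₁, hd₂, hd₃⟩ := exists_closed_of_small hμ ha htop
      (mk_comap_supported_le π hπ hμ hA hM hker (hsupp c hc))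
    refine ⟨⟨⋃ b : Bool, if b then c else d, IsHillClosed.iUnion fun b => ?_, ?_⟩, ?_, ?_⟩
    · cases b
      · exact hd₁
      · exact hc.1
    · have : (⋃ b : Bool, if b then c else d) ⊆ c ∪ d := by
        refine Set.iUnion_subset fun b => ?_
        cases b
        · exact Set.subset_union_right
        · exact Set.subset_union_left
      refine (Cardinal.mk_le_mk_of_subset this).trans ((Cardinal.mk_union_le _ _).trans ?_)
      exact (add_le_add hc.2 hd₃).trans (Cardinal.add_eq_self hμ).le
    · exact fun x hx => Set.mem_iUnion.2 ⟨true, hx⟩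
    · exact le_trans (fun z hz => hd₂ hz)
        (hillSpan_mono fun x hx => Set.mem_iUnion.2 ⟨false, hx⟩)
  choose next hnext₁ hnext₂ using hnext
  let start : {c // Small c} := ⟨∅, fun i hi => absurd hi (Set.notMem_empty i), by simp⟩
  let c : ℕ → {c // Small c} := fun n => next^[n] start
  have hc : ∀ n, c (n + 1) = next (c n) := fun n => Function.iterate_succ_apply' next n start
  have hmono : Monotone fun n => (c n).1 := monotone_nat_of_le_succ fun n => by
    rw [hc]; exact hnext₁ (c n)
  have hsuppmono : Monotone fun n => supp (c n).1 := by
    intro m n h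
    refine Set.iUnion_subset fun z => ?_
    exact Set.subset_iUnion_of_subset ⟨z.1, hillSpan_mono (hmono h) z.2⟩ subset_rfl
  let C : Set ι := ⋃ n, (c n).1
  let Y : Set H := ⋃ n, supp (c n).1
  have hCclosed : IsHillClosed a C := IsHillClosed.iUnion fun n => (c n).2.1
  have hY : Cardinal.mk Y ≤ μ := by
    let e := ULift.{u} ℕ
    have : Y = ⋃ n : e, supp (c n.down).1 := by
      ext x
      simp only [Y, Set.mem_iUnion]
      exact ⟨fun ⟨n, hn⟩ => ⟨⟨n⟩, hn⟩, fun ⟨n, hn⟩ => ⟨n.down, hn⟩⟩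
    rw [this]
    refine (Cardinal.mk_iUnion_le _).trans ((mul_le_mul' ?_
      (ciSup_le' fun n : e => hsupp _ (c n.down).2)).trans (Cardinal.mul_eq_self hμ).le)
    exact Cardinal.mk_le_aleph0.trans hμ
  have hspan : hillSpan a C = (Finsupp.supported M A Y).comap π := by
    apply le_antisymm
    · refine iSup_le fun i => ?_
      obtain ⟨n, hn⟩ := Set.mem_iUnion.1 i.2
      intro z hz
      have hz' : z ∈ hillSpan a (c n).1 := le_hillSpan hn hz
      change ((π z).support : Set H) ⊆ Y
      exact (Set.subset_iUnion (fun z : hillSpan a (c n).1 => ((π z.1).support : Set H))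
        ⟨z, hz'⟩).trans (Set.subset_iUnion (fun n => supp (c n).1) n)
    · intro z hz
      have hz' : ((π z).support : Set H) ⊆ ⋃ n, supp (c n).1 := hz
      obtain ⟨n, hn⟩ : ∃ n, ((π z).support : Set H) ⊆ supp (c n).1 :=
        hsuppmono.directed_le.exists_mem_subset_of_finset_subset_biUnion hz'
      have h1 := hnext₂ (c n) (show z ∈ (Finsupp.supported M A (supp (c n).1)).comap π from hn)
      rw [← hc] at h1
      exact hillSpan_mono (Set.subset_iUnion (fun n => (c n).1) (n + 1)) h1
  -- Since `|Y| ≤ μ < 2 ^ μ`, some copy of `M` survives in the quotient; the coordinate `e` and its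
  -- inclusion split it off.
  obtain ⟨e, he⟩ : ∃ e, e ∉ Y := by
    by_contra hcon
    push Not at hcon
    have : Y = Set.univ := Set.eq_univ_of_forall hcon
    rw [this, Cardinal.mk_univ, hH] at hY
    exact (Cardinal.cantor μ).not_ge hY
  let N := hillSpan a C
  have hfilt := (hCclosed.isFilteredOver hstep htop).map N.mkQ (Submodule.ker_mkQ N).le
  rw [Submodule.mkQ_map_self, Submodule.map_top, Submodule.range_mkQ] at hfilt
  let r : (L ⧸ N) →ₗ[A] M := N.liftQ (Finsupp.lapply e ∘ₗ π) (by
    intro z hz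
    have hz' : z ∈ (Finsupp.supported M A Y).comap π := hspan ▸ hz
    have hz'' : ((π z).support : Set H) ⊆ Y := hz'
    change π z e = 0
    by_contra h0
    exact he (hz'' (Finsupp.mem_support_iff.2 h0)))
  obtain ⟨t, ht⟩ := exists_factor_of_surjective π hπ N.mkQ (by
    intro z hz
    rw [Submodule.mkQ_apply, Submodule.Quotient.mk_eq_zero]
    change z ∈ hillSpan a C
    rw [hspan, Submodule.mem_comap, hz]
    exact Submodule.zero_mem _)
  obtain ⟨E⟩ := exists_prod_equiv_of_section r (t ∘ₗ Finsupp.lsingle e) (by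
    intro m
    obtain ⟨z, hz⟩ := hπ (Finsupp.single e m)
    rw [LinearMap.comp_apply, Finsupp.lsingle_apply, ← hz, ht]
    change π z e = m
    rw [hz, Finsupp.single_eq_same])
  exact ⟨ModuleCat.of A (L ⧸ N), ModuleCat.of A (LinearMap.ker r),
    filtClass_of_isFilteredOver hfilt, ⟨E⟩⟩

end DirectSummands

/-! ### Limits of chains of length `κ`. -/

section Chains

variable {A : Type u} [Ring A]

/-- Both hypotheses on `𝒜` considered in the theorem. -/
def IsOrthogonalOrDeconstructible (𝒜 : ObjectProperty (ModuleCat.{u} A)) : Prop :=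
  (∃ ℬ : ObjectProperty (ModuleCat.{u} A), 𝒜 = leftExtOrthogonal ℬ) ∨
    ((∃ 𝒮 : Set (ModuleCat.{u} A), Small.{u} 𝒮 ∧ 𝒜 = FiltClass (fun X => X ∈ 𝒮)) ∧
      ClosedUnderDirectSummands 𝒜)

variable {𝒜 : ObjectProperty (ModuleCat.{u} A)}

theorem IsOrthogonalOrDeconstructible.closedUnderFiltrations
    (h : IsOrthogonalOrDeconstructible 𝒜) : ClosedUnderFiltrations 𝒜 := by
  obtain ⟨ℬ, rfl⟩ | ⟨⟨𝒮, -, rfl⟩, -⟩ := h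
  · exact closedUnderFiltrations_leftExtOrthogonal ℬ
  · exact closedUnderFiltrations_filtClass

/-- The size of the tree is chosen after the counting argument is fixed: it must dominate `B` in the
orthogonal case, and the ring, the limit and all members of `𝒮` in the other. -/
theorem colimit_mem_of_wellOrdered {κ : Cardinal.{u}} (hκ : κ.IsRegular)
    (hlim : ClosedUnderKContinuousLimits (Order.succ κ) 𝒜)
    (h : IsOrthogonalOrDeconstructible 𝒜)
    {C : κ.ord.ToType ⥤ ModuleCat.{u} A} (hC : ∀ α, 𝒜 (C.obj α))
    (hcont : ∀ γ, (Set.Iio γ).Nonempty → ∃ c : Cocone (subsystem C (Set.Iio γ)),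
      Nonempty (IsColimit c) ∧ 𝒜 c.pt)
    (c : Cocone C) (hc : IsColimit c) : 𝒜 c.pt := by
  have htree := exists_tree_module hκ hlim h.closedUnderFiltrations hC hcont c hc
  obtain ⟨ℬ, rfl⟩ | ⟨⟨𝒮, hsmall, rfl⟩, hsum⟩ := h
  · intro B hB
    obtain ⟨E, C', ψ, hE, ⟨eψ⟩, hψ⟩ := exists_liftsAlong_iff B
    obtain ⟨μ, H, L, π, hθ, hH, hker, hπ, hL⟩ :=
      htree (max Cardinal.aleph0 (Cardinal.mk (LinearMap.ker ψ)))
    rw [hψ]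
    exact liftsAlong_of_small_kernel ψ ((le_max_left _ _).trans hθ)
      ((le_max_right _ _).trans hθ) hH ((hψ L).1 (hL B hB)) π hπ hker
  · let ν := ⨆ x : Shrink.{u} 𝒮, Cardinal.mk ((equivShrink 𝒮).symm x).1
    have hν : ∀ X, X ∈ 𝒮 → Cardinal.mk X ≤ ν := by
      intro X hX
      have := le_ciSup (f := fun x : Shrink.{u} 𝒮 => Cardinal.mk ((equivShrink 𝒮).symm x).1)
        Cardinal.bddAbove_of_small (equivShrink 𝒮 ⟨X, hX⟩)
      simpa using this
    obtain ⟨μ, H, L, π, hθ, hH, hker, hπ, hL⟩ :=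
      htree (max (max Cardinal.aleph0 ν) (max (Cardinal.mk A) (Cardinal.mk c.pt)))
    obtain ⟨Q, K, hQ, hQM⟩ := exists_filtClass_summand (S := fun X => X ∈ 𝒮)
      (((le_max_left _ _).trans (le_max_left _ _)).trans hθ)
      (((le_max_left _ _).trans (le_max_right _ _)).trans hθ)
      (fun X hX => (hν X hX).trans (((le_max_right _ _).trans (le_max_left _ _)).trans hθ))
      hH (((le_max_right _ _).trans (le_max_right _ _)).trans hθ) hL π hπ hker
    exact hsum Q c.pt K hQ hQM

end Chains

/-! ### Systems indexed by finite subsets. -/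

section FinsetSystems

variable {A : Type u} [Ring A] {𝒜 : ObjectProperty (ModuleCat.{u} A)}

/-- Finite sets have finitely many proper subsets, so recursion can choose a bound for the members
of `s` and all earlier values. -/
theorem exists_monotone_upperBound (I : Type u) [PartialOrder I] [IsDirectedOrder I]
    [Nonempty I] : ∃ v : Finset I → I, Monotone v ∧ ∀ s, ∀ i ∈ s, i ≤ v s := by
  classical
  choose b hb using fun s : Finset I => Finset.exists_le s
  let step : ∀ s : Finset I, (∀ t, t ⊂ s → I) → I := fun s ih =>
    b (s ∪ s.ssubsets.attach.image fun t => ih t.1 (Finset.mem_ssubsets.1 t.2))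
  obtain ⟨v, hv⟩ : ∃ v : Finset I → I, ∀ s, v s = step s fun t _ => v t :=
    ⟨Finset.strongInduction step, Finset.strongInduction_eq step⟩
  refine ⟨v, fun t s hts => ?_, fun s i hi => ?_⟩
  · rcases hts.eq_or_ssubset with rfl | h
    · exact le_rfl
    · rw [hv s]
      exact hb _ _ (Finset.mem_union_right _ (Finset.mem_image.2
        ⟨⟨t, Finset.mem_ssubsets.2 h⟩, Finset.mem_attach _ _, rfl⟩))
  · rw [hv s]
    exact hb _ _ (Finset.mem_union_left _ hi)

/-- A cocone over a system indexed by a partially ordered set. -/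
def coconeOfLE {K : Type u} [PartialOrder K] (F : K ⥤ ModuleCat.{u} A) (P : ModuleCat.{u} A)
    (f : ∀ k, F.obj k ⟶ P) (w : ∀ (i j : K) (h : i ≤ j), F.map (homOfLE h) ≫ f j = f i) :
    Cocone F where
  pt := P
  ι :=
    { app := f
      naturality := fun i j g => (w i j (leOfHom g)).trans (Category.comp_id _).symm }

/-- The finite subsets of `Y`. -/
def finsetsIn {X : Type u} (Y : Set X) : Set (Finset X) := {s | (s : Set X) ⊆ Y}

variable {X : Type u}

theorem finsetsIn_mono {Y Z : Set X} (h : Y ⊆ Z) : finsetsIn Y ⊆ finsetsIn Z :=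
  fun _ hs => Set.Subset.trans hs h

theorem mem_finsetsIn_coe (s : Finset X) : s ∈ finsetsIn (s : Set X) := Set.Subset.rfl

instance (Y : Set X) : Nonempty (finsetsIn Y) :=
  ⟨⟨∅, by simp [finsetsIn]⟩⟩

instance (Y : Set X) : IsDirectedOrder (finsetsIn Y) := by
  classical
  refine ⟨fun s t => ⟨⟨s.1 ∪ t.1, ?_⟩, Finset.subset_union_left, Finset.subset_union_right⟩⟩
  change ((s.1 ∪ t.1 : Finset X) : Set X) ⊆ Y
  rw [Finset.coe_union]
  exact Set.union_subset s.2 t.2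

variable (G : Finset X ⥤ ModuleCat.{u} A)

noncomputable def finsetsInColimitMap {Y Z : Set X} (h : Y ⊆ Z) :
    colimit (subsystem G (finsetsIn Y)) ⟶ colimit (subsystem G (finsetsIn Z)) :=
  colimit.desc (subsystem G (finsetsIn Y))
    (coconeOfLE _ (colimit (subsystem G (finsetsIn Z)))
      (fun s => colimit.ι (subsystem G (finsetsIn Z)) ⟨s.1, finsetsIn_mono h s.2⟩)
      fun s t hst => colimit.w (subsystem G (finsetsIn Z)) (homOfLE
        (show (⟨s.1, finsetsIn_mono h s.2⟩ : finsetsIn Z) ≤ ⟨t.1, finsetsIn_mono h t.2⟩ from hst)))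

theorem ι_finsetsInColimitMap {Y Z : Set X} (h : Y ⊆ Z) (s : finsetsIn Y) :
    colimit.ι (subsystem G (finsetsIn Y)) s ≫ finsetsInColimitMap G h =
      colimit.ι (subsystem G (finsetsIn Z)) ⟨s.1, finsetsIn_mono h s.2⟩ :=
  colimit.ι_desc _ _

theorem finsetsInColimitMap_ι_apply {Y Z : Set X} (h : Y ⊆ Z) (s : finsetsIn Y) (x : G.obj s.1) :
    (finsetsInColimitMap G h).hom ((colimit.ι (subsystem G (finsetsIn Y)) s).hom x) =
      (colimit.ι (subsystem G (finsetsIn Z)) ⟨s.1, finsetsIn_mono h s.2⟩).hom x :=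
  LinearMap.congr_fun (congrArg ModuleCat.Hom.hom (ι_finsetsInColimitMap G h s)) x

/-- The direct limits of a system of finite subsets of `X`, restricted to the finite subsets of
each of the subsets of `X` of cardinality at most `κ`. -/
noncomputable def finsetsInColimit (κ : Cardinal.{u}) :
    {Y : Set X // Cardinal.mk Y ≤ κ} ⥤ ModuleCat.{u} A where
  obj Y := colimit (subsystem G (finsetsIn Y.1))
  map f := finsetsInColimitMap G (leOfHom f)
  map_id Y := colimit.hom_ext fun s => by
    rw [ι_finsetsInColimitMap, Category.comp_id]
  map_comp f g := colimit.hom_ext fun s => by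
    rw [ι_finsetsInColimitMap, ← Category.assoc, ι_finsetsInColimitMap]
    exact (ι_finsetsInColimitMap G (leOfHom g) ⟨s.1, finsetsIn_mono (leOfHom f) s.2⟩).symm

theorem finsetsInColimit_map_ι_apply {κ : Cardinal.{u}} {Y Z : {Y : Set X // Cardinal.mk Y ≤ κ}}
    (h : Y ≤ Z) (s : finsetsIn Y.1) (x : G.obj s.1) :
    ((finsetsInColimit G κ).map (homOfLE h)).hom
        ((colimit.ι (subsystem G (finsetsIn Y.1)) s).hom x) =
      (colimit.ι (subsystem G (finsetsIn Z.1)) ⟨s.1, finsetsIn_mono h s.2⟩).hom x :=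
  finsetsInColimitMap_ι_apply G h s x

theorem ι_eq_zero_of_map_eq_zero {Y : Set X} {s t : Finset X} (hs : s ∈ finsetsIn Y)
    (ht : t ∈ finsetsIn Y) (h : s ≤ t) {x : G.obj s} (hx : (G.map (homOfLE h)).hom x = 0) :
    (colimit.ι (subsystem G (finsetsIn Y)) ⟨s, hs⟩).hom x = 0 := by
  have := cocone_w_apply (colimit.cocone (subsystem G (finsetsIn Y))) (i := ⟨s, hs⟩)
    (j := ⟨t, ht⟩) h x
  exact this.symm.trans ((congrArg _ hx).trans (map_zero _))

/-- A finite subset of the union of a chain lies in one member, so the limits over finite subsets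
commute with such unions. -/
theorem isKContinuous_finsetsInColimit {κ : Cardinal.{u}} (hκ : Cardinal.aleph0 ≤ κ) :
    IsKContinuous (Order.succ κ) (finsetsInColimit G κ) := by
  intro J hJne hJ hJκ
  have hJκ' : Cardinal.mk J ≤ κ := Order.lt_succ_iff.1 hJκ
  have : Nonempty J := hJne.to_subtype
  let S : {Y : Set X // Cardinal.mk Y ≤ κ} := ⟨⋃ Y : J, Y.1.1,
    (Cardinal.mk_iUnion_le _).trans ((mul_le_mul' hJκ' (ciSup_le' fun Y : J => Y.1.2)).trans
      (Cardinal.mul_eq_self hκ).le)⟩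
  have hS : IsLUB J S := ⟨fun Y hY => Set.subset_iUnion (fun Y : J => Y.1.1) ⟨Y, hY⟩,
    fun Z hZ => Set.iUnion_subset fun Y => hZ Y.2⟩
  have : IsDirectedOrder J := ⟨fun Y Z => by
    rcases hJ.total Y.2 Z.2 with h | h
    · exact ⟨Z, h, le_rfl⟩
    · exact ⟨Y, le_rfl, h⟩⟩
  have hfin : ∀ s ∈ finsetsIn S.1, ∃ Y : J, s ∈ finsetsIn Y.1.1 := fun s hs =>
    (Monotone.directed_le (f := fun Y : J => Y.1.1)
      fun Y Z h => h).exists_mem_subset_of_finset_subset_biUnion hs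
  refine ⟨S, hS, nonempty_isColimit_of_elementwise (fun z => ?_) fun Y z hz => ?_⟩
  · obtain ⟨s, x, rfl⟩ :=
      exists_rep_of_isColimit (colimit.isColimit (subsystem G (finsetsIn S.1))) z
    obtain ⟨Y, hY⟩ := hfin s.1 s.2
    exact ⟨Y, (colimit.ι (subsystem G (finsetsIn Y.1.1)) ⟨s.1, hY⟩).hom x,
      finsetsInColimit_map_ι_apply G (hS.1 Y.2) ⟨s.1, hY⟩ x⟩
  · obtain ⟨s, x, rfl⟩ :=
      exists_rep_of_isColimit (colimit.isColimit (subsystem G (finsetsIn Y.1.1))) z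
    have hz' := (finsetsInColimit_map_ι_apply G (hS.1 Y.2) s x).symm.trans hz
    obtain ⟨t, hst, ht⟩ := exists_map_eq_zero_of_isColimit
      (colimit.isColimit (subsystem G (finsetsIn S.1))) hz'
    obtain ⟨Z, hZ⟩ := hfin t.1 t.2
    obtain ⟨W, hYW, hZW⟩ := exists_ge_ge Y Z
    exact ⟨W, hYW, (finsetsInColimit_map_ι_apply G (Y := Y.1) (Z := W.1) hYW s x).trans
      (ι_eq_zero_of_map_eq_zero G _ (finsetsIn_mono hZW hZ) hst ht)⟩

/-- Every finite set has size at most `κ`, so the limit over all finite subsets can be computed in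
two stages, the outer one `κ⁺`-continuous. -/
theorem colimit_mem_of_finsetsIn {κ : Cardinal.{u}} (hκ : Cardinal.aleph0 ≤ κ)
    (hlim : ClosedUnderKContinuousLimits (Order.succ κ) 𝒜)
    (hG : ∀ Y : Set X, Cardinal.mk Y ≤ κ → 𝒜 (colimit (subsystem G (finsetsIn Y))))
    (c : Cocone G) (hc : IsColimit c) : 𝒜 c.pt := by
  classical
  have hunion : ∀ Y Z : Set X, Cardinal.mk Y ≤ κ → Cardinal.mk Z ≤ κ →
      Cardinal.mk (Y ∪ Z : Set X) ≤ κ := fun Y Z hY hZ =>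
    (Cardinal.mk_union_le _ _).trans ((add_le_add hY hZ).trans (Cardinal.add_eq_self hκ).le)
  have hfin : ∀ s : Finset X, Cardinal.mk (s : Set X) ≤ κ := fun s =>
    (Cardinal.lt_aleph0_of_finite _).le.trans hκ
  have : IsDirectedOrder {Y : Set X // Cardinal.mk Y ≤ κ} :=
    ⟨fun Y Z => ⟨⟨Y.1 ∪ Z.1, hunion _ _ Y.2 Z.2⟩, Set.subset_union_left, Set.subset_union_right⟩⟩
  have : Nonempty {Y : Set X // Cardinal.mk Y ≤ κ} := ⟨⟨∅, by simp⟩⟩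
  let sub : ∀ Y : Set X, Cocone (subsystem G (finsetsIn Y)) := fun Y =>
    coconeOfLE _ c.pt (fun s => c.ι.app s.1) fun s t h => c.w (homOfLE h)
  let d : Cocone (finsetsInColimit G κ) :=
    coconeOfLE _ c.pt (fun Y => colimit.desc _ (sub Y.1)) fun Y Z h => colimit.hom_ext fun s => by
      refine (Category.assoc _ _ _).symm.trans ?_
      refine (congrArg (· ≫ colimit.desc _ (sub Z.1)) (ι_finsetsInColimitMap G h s)).trans ?_
      exact (colimit.ι_desc (sub Z.1) _).trans (colimit.ι_desc (sub Y.1) s).symm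
  have hd : ∀ (Y : {Y : Set X // Cardinal.mk Y ≤ κ}) (s : finsetsIn Y.1) (x : G.obj s.1),
      (d.ι.app Y).hom ((colimit.ι (subsystem G (finsetsIn Y.1)) s).hom x) =
        (c.ι.app s.1).hom x := fun Y s x =>
    LinearMap.congr_fun (congrArg ModuleCat.Hom.hom (colimit.ι_desc (sub Y.1) s)) x
  obtain ⟨h⟩ : Nonempty (IsColimit d) := by
    refine nonempty_isColimit_of_elementwise (fun z => ?_) fun Y z hz => ?_
    · obtain ⟨s, x, rfl⟩ := exists_rep_of_isColimit hc z
      exact ⟨⟨s, hfin s⟩, (colimit.ι (subsystem G (finsetsIn (s : Set X)))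
        ⟨s, mem_finsetsIn_coe s⟩).hom x, hd ⟨s, hfin s⟩ ⟨s, mem_finsetsIn_coe s⟩ x⟩
    · obtain ⟨s, x, rfl⟩ :=
        exists_rep_of_isColimit (colimit.isColimit (subsystem G (finsetsIn Y.1))) z
      obtain ⟨t, hst, ht⟩ := exists_map_eq_zero_of_isColimit hc ((hd Y s x).symm.trans hz)
      have hY : Y ≤ ⟨Y.1 ∪ t, hunion _ _ Y.2 (hfin t)⟩ := Set.subset_union_left
      exact ⟨_, hY, (finsetsInColimit_map_ι_apply G hY s x).trans
        (ι_eq_zero_of_map_eq_zero G _ Set.subset_union_right hst ht)⟩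
  exact hlim _ (finsetsInColimit G κ) (isKContinuous_finsetsInColimit G hκ)
    (fun Y => hG Y.1 Y.2) d h

end FinsetSystems

/-! ### Reduction of continuous systems to chains. -/

section ContinuousSystems

variable {A : Type u} [Ring A] {𝒜 : ObjectProperty (ModuleCat.{u} A)} {κ : Cardinal.{u}}
  {I : Type u} [PartialOrder I] {F : I ⥤ ModuleCat.{u} A}

theorem ClosedUnderFiltrations.of_isColimit (h : ClosedUnderFiltrations 𝒜) {K : Type u}
    [PartialOrder K] {D : K ⥤ ModuleCat.{u} A} {c d : Cocone D} (hc : IsColimit c)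
    (hd : IsColimit d) (h𝒜 : 𝒜 c.pt) : 𝒜 d.pt :=
  h.of_linearEquiv (hc.coconePointUniqueUpToIso hd).toLinearEquiv h𝒜

theorem IsKContinuous.exists_isLUB_range (hF : IsKContinuous κ F) {Λ : Type u} [LinearOrder Λ]
    [Nonempty Λ] (hΛ : Cardinal.mk Λ < κ) {s : Λ → I} (hs : Monotone s) :
    ∃ (t : I) (ht : IsLUB (Set.range s) t),
      (∀ z : F.obj t, ∃ (β : Λ) (x : F.obj (s β)),
        (F.map (homOfLE (ht.1 ⟨β, rfl⟩))).hom x = z) ∧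
      ∀ (β : Λ) (x : F.obj (s β)), (F.map (homOfLE (ht.1 ⟨β, rfl⟩))).hom x = 0 →
        ∃ (γ : Λ) (h : β ≤ γ), (F.map (homOfLE (hs h))).hom x = 0 := by
  have hchain : IsChain (· ≤ ·) (Set.range s) := by
    rintro _ ⟨β, rfl⟩ _ ⟨γ, rfl⟩ -
    exact (le_total β γ).imp (fun h => hs h) fun h => hs h
  obtain ⟨t, ht, ⟨hc⟩⟩ := hF (Set.range s) (Set.range_nonempty s) hchain
    (Cardinal.mk_range_le.trans_lt hΛ)
  have : Nonempty (Set.range s) := (Set.range_nonempty s).to_subtype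
  have : IsDirectedOrder (Set.range s) := ⟨fun i j => by
    rcases hchain.total i.2 j.2 with h | h
    · exact ⟨j, h, le_rfl⟩
    · exact ⟨i, le_rfl, h⟩⟩
  refine ⟨t, ht, fun z => ?_, fun β x hx => ?_⟩
  · obtain ⟨⟨_, β, rfl⟩, x, hx⟩ := exists_rep_of_isColimit hc z
    exact ⟨β, x, hx⟩
  · obtain ⟨⟨_, γ, rfl⟩, h, hγ⟩ :=
      exists_map_eq_zero_of_isColimit hc (k := ⟨s β, β, rfl⟩) (x := x) hx
    refine ⟨max β γ, le_max_left _ _, ?_⟩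
    rw [← map_map_apply F h (hs (le_max_right β γ))]
    exact (congrArg _ hγ).trans (map_zero _)

/-- `i` is the supremum of the elements `v s`, for finite `s ⊆ Y`, and `F.obj i` is the direct limit
of the modules `F.obj (v s)`. -/
structure IsFinsetLimit (F : I ⥤ ModuleCat.{u} A) {v : Finset I → I} (hv : Monotone v) (Y : Set I)
    (i : I) : Prop where
  le : ∀ s ∈ finsetsIn Y, v s ≤ i
  least : ∀ j, (∀ s ∈ finsetsIn Y, v s ≤ j) → i ≤ j
  rep : ∀ z : F.obj i, ∃ (s : Finset I) (hs : s ∈ finsetsIn Y) (x : F.obj (v s)),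
    (F.map (homOfLE (le s hs))).hom x = z
  eq_zero : ∀ (s : Finset I) (hs : s ∈ finsetsIn Y) (x : F.obj (v s)),
    (F.map (homOfLE (le s hs))).hom x = 0 →
      ∃ t ∈ finsetsIn Y, ∃ h : s ≤ t, (F.map (homOfLE (hv h))).hom x = 0

variable {v : Finset I → I} {hv : Monotone v}

theorem IsFinsetLimit.mono {Y Z : Set I} {i j : I} (hi : IsFinsetLimit F hv Y i)
    (hj : IsFinsetLimit F hv Z j) (h : Y ⊆ Z) : i ≤ j :=
  hi.least j fun s hs => hj.le s (finsetsIn_mono h hs)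

theorem isFinsetLimit_finset (F : I ⥤ ModuleCat.{u} A) (hv : Monotone v) (s : Finset I) :
    IsFinsetLimit F hv s (v s) where
  le _ ht := hv (Finset.coe_subset.1 ht)
  least _ hj := hj s (mem_finsetsIn_coe s)
  rep z := ⟨s, mem_finsetsIn_coe s, z, map_refl_apply F _ z⟩
  eq_zero _ ht _ hx := ⟨s, mem_finsetsIn_coe s, Finset.coe_subset.1 ht, hx⟩

/-- The suprema for the `Y β` form a short chain; continuity at its supremum combines with the limit
property at each `β`. -/
theorem IsKContinuous.exists_isFinsetLimit_iUnion (hF : IsKContinuous κ F) {Λ : Type u}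
    [LinearOrder Λ] [Nonempty Λ] (hΛ : Cardinal.mk Λ < κ) {Y : Λ → Set I} (hY : Monotone Y)
    (hlim : ∀ β, ∃ i, IsFinsetLimit F hv (Y β) i) : ∃ i, IsFinsetLimit F hv (⋃ β, Y β) i := by
  choose s hs using hlim
  have hmono : Monotone s := fun β γ h => (hs β).mono (hs γ) (hY h)
  have hfin : ∀ f ∈ finsetsIn (⋃ β, Y β), ∃ β, f ∈ finsetsIn (Y β) := fun f hf =>
    hY.directed_le.exists_mem_subset_of_finset_subset_biUnion hf
  obtain ⟨t, ht, hrep, hzero⟩ := hF.exists_isLUB_range hΛ hmono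
  have hst : ∀ β, s β ≤ t := fun β => ht.1 ⟨β, rfl⟩
  have hle : ∀ f ∈ finsetsIn (⋃ β, Y β), v f ≤ t := fun f hf => by
    obtain ⟨β, hβ⟩ := hfin f hf
    exact ((hs β).le f hβ).trans (hst β)
  refine ⟨t, hle, fun j hj => ht.2 ?_, fun z => ?_, fun f hf x hx => ?_⟩
  · rintro _ ⟨β, rfl⟩
    exact (hs β).least j fun f hf => hj f (finsetsIn_mono (Set.subset_iUnion Y β) hf)
  · obtain ⟨β, y, rfl⟩ := hrep z
    obtain ⟨f, hf, x, rfl⟩ := (hs β).rep y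
    exact ⟨f, finsetsIn_mono (Set.subset_iUnion Y β) hf, x, (map_map_apply F _ _ x).symm⟩
  · obtain ⟨β, hβ⟩ := hfin f hf
    obtain ⟨γ, h, hγ⟩ := hzero β ((F.map (homOfLE ((hs β).le f hβ))).hom x)
      ((map_map_apply F _ (hst β) x).trans hx)
    rw [map_map_apply] at hγ
    obtain ⟨g, hg, hfg, h0⟩ := (hs γ).eq_zero f (finsetsIn_mono (hY h) hβ) x hγ
    exact ⟨g, finsetsIn_mono (Set.subset_iUnion Y γ) hg, hfg, h0⟩

/-- Induction on `|Y|`: a finite `Y` has the value `v Y`, and an infinite one is the union of a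
chain of fewer than `κ` subsets of smaller cardinality. -/
theorem IsKContinuous.exists_isFinsetLimit (hF : IsKContinuous κ F) (hv : Monotone v) {Y : Set I}
    (hY : Cardinal.mk Y < κ) : ∃ i, IsFinsetLimit F hv Y i := by
  induction hμ : Cardinal.mk Y using WellFoundedLT.induction generalizing Y with
  | ind μ ih =>
    rcases lt_or_ge μ Cardinal.aleph0 with hfin | hinf
    · have : Y.Finite := Cardinal.lt_aleph0_iff_set_finite.1 (hμ ▸ hfin)
      have h := isFinsetLimit_finset F hv this.toFinset
      rw [this.coe_toFinset] at h
      exact ⟨_, h⟩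
    · obtain ⟨e⟩ : Nonempty (μ.ord.ToType ≃ Y) := Cardinal.eq.1 (by rw [hμ, Cardinal.mk_ord_toType])
      have : Nonempty μ.ord.ToType := by
        rw [← Cardinal.mk_ne_zero_iff, Cardinal.mk_ord_toType]
        exact (Cardinal.aleph0_pos.trans_le hinf).ne'
      -- Closed initial segments make the union visibly all of `Y`; as `μ` is infinite, the extra
      -- point does not spoil the bound.
      have hsmall : ∀ β : μ.ord.ToType,
          Cardinal.mk ((fun γ => (e γ : I)) '' Set.Iic β) < μ := fun β => by
        refine Cardinal.mk_image_le.trans_lt ?_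
        rw [← Set.Iio_insert]
        refine (Cardinal.mk_insert_le).trans_lt (Cardinal.add_lt_of_lt hinf ?_
          (Cardinal.one_lt_aleph0.trans_le hinf))
        exact mk_Iio_ordToType_lt β
      have hunion : (⋃ β, (fun γ => (e γ : I)) '' Set.Iic β) = Y := by
        ext y
        simp only [Set.mem_iUnion]
        constructor
        · rintro ⟨_, γ, -, rfl⟩
          exact (e γ).2
        · intro hy
          exact ⟨e.symm ⟨y, hy⟩, e.symm ⟨y, hy⟩, Set.self_mem_Iic, by simp⟩
      rw [← hunion]
      refine hF.exists_isFinsetLimit_iUnion ?_ (fun β γ h => Set.image_mono (Set.Iic_subset_Iic.2 h))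
        fun β => ih _ (hsmall β) ((hsmall β).trans (hμ ▸ hY)) rfl
      rw [Cardinal.mk_ord_toType]
      exact hμ ▸ hY

theorem IsFinsetLimit.nonempty_isColimit {Y : Set I} {i : I} (h : IsFinsetLimit F hv Y i) :
    ∃ c : Cocone (subsystem (hv.functor ⋙ F) (finsetsIn Y)), c.pt = F.obj i ∧
      Nonempty (IsColimit c) := by
  refine ⟨coconeOfLE _ (F.obj i) (fun s => F.map (homOfLE (h.le s.1 s.2)))
    fun s t hst => (F.map_comp _ _).symm, rfl, ?_⟩
  refine nonempty_isColimit_of_elementwise (fun z => ?_) fun s x hx => ?_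
  · obtain ⟨s, hs, x, hx⟩ := h.rep z
    exact ⟨⟨s, hs⟩, x, hx⟩
  · obtain ⟨t, ht, hst, h0⟩ := h.eq_zero s.1 s.2 x hx
    exact ⟨⟨t, ht⟩, hst, h0⟩

/-- For `|Y| = κ`, the initial segments of an enumeration of `Y` give a chain of members of the
system, to which the tree argument applies. -/
theorem colimit_finsetsIn_mem (hκ : κ.IsRegular)
    (hlim : ClosedUnderKContinuousLimits (Order.succ κ) 𝒜)
    (h : IsOrthogonalOrDeconstructible 𝒜) (hF : IsKContinuous κ F) (h𝒜 : ∀ i, 𝒜 (F.obj i))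
    (hv : Monotone v) {Y : Set I} (hY : Cardinal.mk Y ≤ κ) :
    𝒜 (colimit (subsystem (hv.functor ⋙ F) (finsetsIn Y))) := by
  rcases hY.lt_or_eq with hlt | heq
  · obtain ⟨i, hi⟩ := hF.exists_isFinsetLimit hv hlt
    obtain ⟨c, hci, ⟨hc⟩⟩ := hi.nonempty_isColimit
    exact h.closedUnderFiltrations.of_isColimit hc (colimit.isColimit _) (hci ▸ h𝒜 i)
  obtain ⟨e⟩ : Nonempty (κ.ord.ToType ≃ Y) := Cardinal.eq.1 (by rw [heq, Cardinal.mk_ord_toType])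
  let Z : κ.ord.ToType → Set I := fun β => (fun γ => (e γ : I)) '' Set.Iio β
  have hZ : Monotone Z := fun β γ h => Set.image_mono (Set.Iio_subset_Iio h)
  have hZY : ∀ β, Z β ⊆ Y := by
    rintro β _ ⟨γ, -, rfl⟩
    exact (e γ).2
  choose s hs using fun β => hF.exists_isFinsetLimit hv
    (Cardinal.mk_image_le.trans_lt (mk_Iio_ordToType_lt β) : Cardinal.mk (Z β) < κ)
  have hmono : Monotone s := fun β γ h => (hs β).mono (hs γ) (hZ h)
  let C : κ.ord.ToType ⥤ ModuleCat.{u} A := hmono.functor ⋙ F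
  -- The limit below `γ` is the module at the supremum of the `s β` with `β < γ`; it need not be `C
  -- γ`.
  have hcont : ∀ γ, (Set.Iio γ).Nonempty → ∃ c : Cocone (subsystem C (Set.Iio γ)),
      Nonempty (IsColimit c) ∧ 𝒜 c.pt := by
    intro γ hγ
    have : Nonempty (Set.Iio γ) := hγ.to_subtype
    obtain ⟨t, ht, hrep, hzero⟩ := hF.exists_isLUB_range (mk_Iio_ordToType_lt γ)
      (s := fun β : Set.Iio γ => s β.1) (fun β β' h => hmono h)
    refine ⟨coconeOfLE _ (F.obj t) (fun β => F.map (homOfLE (ht.1 ⟨β, rfl⟩)))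
      fun β β' h => (F.map_comp _ _).symm,
      nonempty_isColimit_of_elementwise (fun z => ?_) fun β x hx => ?_, h𝒜 t⟩
    · exact hrep z
    · exact hzero β x hx
  have hmem := colimit_mem_of_wellOrdered hκ hlim h (C := C) (fun α => h𝒜 (s α)) hcont _
    (colimit.isColimit C)
  have : Nonempty κ.ord.ToType := by
    rw [← Cardinal.mk_ne_zero_iff, Cardinal.mk_ord_toType]
    exact hκ.pos.ne'
  -- A finite subset of `Y` is already contained in some proper initial segment; `lev` chooses one,
  -- and `hι` shows that the choice is irrelevant.
  have hfin : ∀ f : finsetsIn Y, ∃ β, f.1 ∈ finsetsIn (Z β) := by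
    intro f
    obtain ⟨β, hβ⟩ := exists_bound_of_isRegular hκ
      ((Cardinal.lt_aleph0_of_finite f.1).trans_le hκ.aleph0_le)
      (fun y => e.symm ⟨y.1, f.2 y.2⟩)
    exact ⟨β, fun y hy => ⟨e.symm ⟨y, f.2 hy⟩, hβ ⟨y, hy⟩, by simp⟩⟩
  choose lev hlev using hfin
  have hι : ∀ (f : finsetsIn Y) (β β' : κ.ord.ToType) (hf : f.1 ∈ finsetsIn (Z β))
      (hf' : f.1 ∈ finsetsIn (Z β')) (x : F.obj (v f.1)),
      (colimit.ι C β).hom ((F.map (homOfLE ((hs β).le _ hf))).hom x) =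
        (colimit.ι C β').hom ((F.map (homOfLE ((hs β').le _ hf'))).hom x) := by
    have key : ∀ (f : finsetsIn Y) (β β' : κ.ord.ToType) (hf : f.1 ∈ finsetsIn (Z β))
        (h : β ≤ β') (x : F.obj (v f.1)),
        (colimit.ι C β).hom ((F.map (homOfLE ((hs β).le _ hf))).hom x) =
          (colimit.ι C β').hom ((F.map (homOfLE ((hs β').le _ (finsetsIn_mono (hZ h) hf)))).hom x) := by
      intro f β β' hf h x
      rw [← map_map_apply F ((hs β).le _ hf) (hmono h)]
      exact (cocone_w_apply (colimit.cocone C) h _).symm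
    intro f β β' hf hf' x
    rcases le_total β β' with h | h
    · exact key f β β' hf h x
    · exact (key f β' β hf' h x).symm
  let d : Cocone (subsystem (hv.functor ⋙ F) (finsetsIn Y)) :=
    coconeOfLE _ (colimit C)
      (fun f => F.map (homOfLE ((hs (lev f)).le _ (hlev f))) ≫ colimit.ι C (lev f))
      fun f g k => ModuleCat.hom_ext (LinearMap.ext fun x => by
        have hfg : f.1 ∈ finsetsIn (Z (lev g)) := (Finset.coe_subset.2 k).trans (hlev g)
        refine Eq.trans ?_ (hι f _ _ hfg (hlev f) x)
        exact congrArg (colimit.ι C (lev g)).hom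
          (map_map_apply F (hv k) ((hs (lev g)).le _ (hlev g)) x))
  have hd : ∀ (f : finsetsIn Y) (β : κ.ord.ToType) (hf : f.1 ∈ finsetsIn (Z β))
      (x : F.obj (v f.1)), (d.ι.app f).hom x =
        (colimit.ι C β).hom ((F.map (homOfLE ((hs β).le _ hf))).hom x) := fun f β hf x =>
    hι f _ _ (hlev f) hf x
  obtain ⟨h'⟩ : Nonempty (IsColimit d) := by
    refine nonempty_isColimit_of_elementwise (fun z => ?_) fun f x hx => ?_
    · obtain ⟨β, y, rfl⟩ := exists_rep_of_isColimit (colimit.isColimit C) z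
      obtain ⟨f, hf, x, rfl⟩ := (hs β).rep y
      exact ⟨⟨f, finsetsIn_mono (hZY β) hf⟩, x, hd ⟨f, finsetsIn_mono (hZY β) hf⟩ β hf x⟩
    · obtain ⟨β, hle, hβ⟩ := exists_map_eq_zero_of_isColimit (colimit.isColimit C) hx
      have hβ' := (map_map_apply F ((hs (lev f)).le _ (hlev f)) (hmono hle) x).symm.trans hβ
      obtain ⟨t, ht, hst, h0⟩ := (hs β).eq_zero f.1 (finsetsIn_mono (hZ hle) (hlev f)) x hβ'
      exact ⟨⟨t, finsetsIn_mono (hZY β) ht⟩, hst, h0⟩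
  exact h.closedUnderFiltrations.of_isColimit h' (colimit.isColimit _) hmem

/-- The monotone map `v` is cofinal, so the system indexed by finite subsets of `I` has the same
direct limit. -/
theorem IsOrthogonalOrDeconstructible.closedUnderKContinuousLimits (hκ : κ.IsRegular)
    (hlim : ClosedUnderKContinuousLimits (Order.succ κ) 𝒜)
    (h : IsOrthogonalOrDeconstructible 𝒜) : ClosedUnderKContinuousLimits κ 𝒜 := by
  classical
  intro I _ _ _ F hF h𝒜 c hc
  obtain ⟨v, hv, hle⟩ := exists_monotone_upperBound I
  let d : Cocone (hv.functor ⋙ F) :=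
    coconeOfLE _ c.pt (fun s => c.ι.app (v s)) fun s t h => c.w (homOfLE (hv h))
  obtain ⟨hd⟩ : Nonempty (IsColimit d) := by
    refine nonempty_isColimit_of_elementwise (fun z => ?_) fun s x hx => ?_
    · obtain ⟨i, x, rfl⟩ := exists_rep_of_isColimit hc z
      have hi : i ≤ v {i} := hle {i} i (Finset.mem_singleton_self i)
      exact ⟨{i}, (F.map (homOfLE hi)).hom x, cocone_w_apply c hi x⟩
    · obtain ⟨j, hj, h0⟩ := exists_map_eq_zero_of_isColimit hc (k := v s) (x := x) hx
      have hj' : j ≤ v (s ∪ {j}) := hle _ j (Finset.mem_union_right _ (Finset.mem_singleton_self j))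
      refine ⟨s ∪ {j}, Finset.subset_union_left, ?_⟩
      refine (map_map_apply F hj hj' x).symm.trans ?_
      exact (congrArg _ h0).trans (map_zero _)
  exact colimit_mem_of_finsetsIn (hv.functor ⋙ F) hκ.aleph0_le hlim
    (fun Y hY => colimit_finsetsIn_mem hκ hlim h hF h𝒜 hv hY) d hd

end ContinuousSystems

/-- Right `R`-modules are the modules over the opposite ring `Rᵐᵒᵖ`. -/
theorem theorem2p7 (R : Type u) [Ring R] (κ : Cardinal.{u}) (hκ : κ.IsRegular)
    (𝒜 : ObjectProperty (ModuleCat.{u} Rᵐᵒᵖ))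
    (hlim : ClosedUnderKContinuousLimits (Order.succ κ) 𝒜)
    (h : (∃ ℬ : ObjectProperty (ModuleCat.{u} Rᵐᵒᵖ), 𝒜 = leftExtOrthogonal ℬ) ∨
      ((∃ 𝒮 : Set (ModuleCat.{u} Rᵐᵒᵖ), Small.{u} 𝒮 ∧ 𝒜 = FiltClass (fun X => X ∈ 𝒮)) ∧
        ClosedUnderDirectSummands 𝒜)) :
    ClosedUnderKContinuousLimits κ 𝒜 :=
  IsOrthogonalOrDeconstructible.closedUnderKContinuousLimits hκ hlim h
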